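/- **Theorem 1 (Full implementation, individual rationality and weak budget balance).** *Network.* Let $\mathcal N$ (agents), $\mathcal L$ (links) and $\mathcal K$ (groups) be finite sets. Agent $i$ belongs to the group $k(i)\in\mathcal K$ and uses a nonempty set of links $\mathcal L_i\subseteq\mathcal L$; link $l$ has capacity $c^l>0$. Put $\mathcal N^l=\{i: l\in\mathcal L_i\}$, $\mathcal G_k^l=\{i\in\mathcal N^l: k(i)=k\}$, $\mathcal K^l=\{k:\mathcal G^l_k\ne\emptyset\}$, and assume $|\mathcal K^l|\ge 2$ for every $l$. Each valuation $v_i:[0,\infty)\to\mathbb R$ is strictly concave, increasing and twice continuously differentiable (one-sidedly at $0$). The welfare problem is $$\max_x\ \sum_{i} v_i(x_i)\quad\text{s.t.}\quad x_i\ge 0\ \ \forall i,\qquad \sum_{k\in\mathcal K^l}\max_{i\in\mathcal G_k^l}x_i\le c^l\ \ \forall l .\tag{CP}$$ *Message graph.* Let a tree on $\mathcal N$ be given, with $\mathcal N(i)$ the set of neighbours of $i$, and for each $i$ a chosen neighbour $\Phi(i)\in\mathcal N(i)$. Assume that for each link $l$ the subgraph induced on $\mathcal N^l$ is connected and that for each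 $l$ and $k\in\mathcal K^l$ an agent $c(k,l)\in\mathcal G_k^l$ adjacent to all other agents of $\mathcal G_k^l$ is chosen. Put $I_i=\{h\in\mathcal N(i):\Phi(h)=i\}$, $\mathcal C_i=\{l\in\mathcal L_i: c(k(i),l)=i\}$, $\mathcal N^l(i)=\mathcal N(i)\cap\mathcal N^l$ and $P_i^l=\mathcal G^l_{k(i)}\setminus\{i\}$. *Messages.* Agent $i$ chooses $y_i\ge0$; $\underline{y}_i^l\ge0$, ${}^1p_i^l\ge0$, $w_i^l\ge0$, ${}^1a_i^l>0$ for $l\in\mathcal L_i$; $n_i^{j,l}\ge0$ for $j\in\mathcal N(i)$, $l\in\mathcal L$; $q_i^j\ge0$ for $j\in I_i$; ${}^2p_i^{j,l}\ge0$, ${}^2a_i^{j,l}>0$ for $j\in I_i$, $l\in\mathcal L_j$; ${}^1z_i^l\ge0$, ${}^2z_i^l\ge0$ for $l\in\mathcal C_i$. Put $y_i^l=\underline y_i^l$ if $l\in\mathcal L_i$ and $y_i^l=0$ otherwise. Write $\tilde q_i=q_{\Phi(i)}^i$, $\tilde p_i^l={}^2p_{\Phi(i)}^{i,l}$, $\tilde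 a_i^l={}^2a_{\Phi(i)}^{i,l}$, $c_i^l=c(k(i),l)$. For $l\in\mathcal C_i$ let $${}^1\bar z_i^l=\max\{\tilde q_i,\max_{j\in P_i^l}y_j\},\qquad {}^2\bar z_i^l=\mathbf 1[\,{}^1\bar z_i^l=\tilde q_i]+\sum_{j\in P_i^l}\mathbf 1[\,{}^1\bar z_i^l=y_j],$$ and for $l\in\mathcal L_i\setminus\mathcal C_i$ let ${}^1\bar z_i^l={}^1z^l_{c_i^l}$, ${}^2\bar z_i^l={}^2z^l_{c_i^l}$. For $l\in\mathcal L_i$ let $s_i^l=\tilde q_i\,\mathbf 1[\,{}^1\bar z_i^l=\tilde q_i]/\,{}^2\bar z_i^l$ (read as $0$ if ${}^2\bar z_i^l=0$), and $s_i^l=0$ for $l\notin\mathcal L_i$. *Allocation.* Put $\rho_i^{j,l}=y_j^l+\sum_{h\in\mathcal N(j),h\ne i}n_j^{h,l}$ for $j\in\mathcal N(i)$, $f_i^l=s_i^l+\sum_{j\in\mathcal N(i)}\rho_i^{j,l}$, $r_i=\min_{l:\,f_i^l>0}c^l/f_i^l$, and $\hat x_i(m)=r_iy_i$. If $f_i^l=0$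 for all $l$, then $r_i$ is set to an arbitrary number $r_i^0>0$ fixed in advance. *Taxes.* For $l\in\mathcal L_i$ let $\bar w_{-i}^l=\frac1{|\mathcal N^l(i)|}\sum_{j\in\mathcal N^l(i)}w_j^l$ and $$\hat w_i^l=({}^1a_i^l-\tilde a_i^l)+\begin{cases}\sum_{j\in\mathcal G_{k(i)}^l}{}^1p_j^l, & l\in\mathcal C_i,\\ w_{c_i^l}^l-\tilde p_i^l+{}^1p_i^l,& l\notin\mathcal C_i.\end{cases}$$ The tax is $$\hat t_i(m)=\sum_{j\in I_i}\sum_{l\in\mathcal L_j}\big[({}^2p_i^{j,l}-{}^1p_j^l)^2+({}^2a_i^{j,l}-{}^1a_j^l)^2\big]+\sum_{j\in I_i}(q_i^j-y_j)^2+\sum_{l\in\mathcal L}\hat t_i^l(m),$$ where $\hat t_i^l(m)=\sum_{j\in\mathcal N(i)}(n_i^{j,l}-\rho_i^{j,l})^2$ for $l\notin\mathcal L_i$, while for $l\in\mathcal L_i$ $$\begin{aligned}\hat t_i^l(m)={}&\sum_{j\in\mathcal N(i)}(n_i^{j,l}-\rho_i^{j,l})^2+\tilde p_i^l\hat x_i(m)+(\underline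 y_i^l-s_i^l)^2+\bar w_{-i}^l(\hat w_i^l-\bar w_{-i}^l)(c^l-r_if_i^l)^2\\&+(\hat w_i^l-\bar w_{-i}^l)^2+\tilde p_i^l({}^1p_i^l-\tilde p_i^l)({}^1\bar z_i^l-\tilde q_i)^2+R_i^l,\end{aligned}$$ with $R_i^l=({}^1z_i^l-{}^1\bar z_i^l)^2+({}^2z_i^l-{}^2\bar z_i^l)^2+(w_i^l-\tilde p_i^l-\sum_{j\in P_i^l}{}^1p_j^l)^2$ if $l\in\mathcal C_i$ and $R_i^l=(w_i^l-w_{c_i^l}^l)^2$ if $l\notin\mathcal C_i$. The induced game has utilities $\hat u_i(m)=v_i(\hat x_i(m))-\hat t_i(m)$; equilibria are pure Nash equilibria. *Claim.* (i) The mechanism is distributed: $\hat x_i$ and $\hat t_i$ depend only on the messages of $i$ and of its neighbours. (ii) A Nash equilibrium exists. (iii) Problem (CP) has exactly one solution $x^*$, and every Nash equilibrium $m$ satisfies $\hat x(m)=x^*$, individual rationality $v_i(\hat x_i(m))-\hat t_i(m)\ge v_i(0)$ for all $i$, and weak budget balance $\sum_i\hat t_i(m)\ge0$. -/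

import Mathlib

noncomputable section

namespace Multicast

/-- A multicast network with finite sets `N` of agents, `L` of links and `K` of groups.
`group i` is the group of agent `i`, `route i` is the set of links that carry the data stream of
agent `i`, and `cap l` is the capacity of link `l`.  Every agent's stream uses some link, and at
least two groups compete for every link. -/
structure Network (N L K : Type*) [Fintype N] [Fintype L] [Fintype K] where
  group : N → K
  route : N → Finset L
  cap : L → ℝ
  cap_pos : ∀ l, 0 < cap l
  route_nonempty : ∀ i, (route i).Nonempty
  two_groups : ∀ l, ∃ i j, l ∈ route i ∧ l ∈ route j ∧ group i ≠ group j

/-- The valuation functions: strictly concave, increasing and twice continuously differentiable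
on `[0, ∞)` (with one-sided derivatives at `0`).  Values at negative arguments are irrelevant. -/
structure IsValuation (v : ℝ → ℝ) : Prop where
  strictConcave : StrictConcaveOn ℝ (Set.Ici 0) v
  monotone : MonotoneOn v (Set.Ici 0)
  contDiff : ContDiffOn ℝ 2 v (Set.Ici 0)

section Problem

variable {N L K : Type*} [Fintype N] [Fintype L] [Fintype K] (net : Network N L K)

open Classical in
/-- The agents using link `l`. -/
def users (l : L) : Finset N := Finset.univ.filter fun i => l ∈ net.route i

open Classical in
/-- The agents of group `k` using link `l`. -/
def groupUsers (k : K) (l : L) : Finset N := (users net l).filter fun i => net.group i = k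

open Classical in
/-- The groups using link `l`. -/
def linkGroups (l : L) : Finset K := (users net l).image net.group

open Classical in
/-- The largest value of `x` on the users of link `l` in group `k`
(only used for groups that do use the link). -/
def groupMax (x : N → ℝ) (k : K) (l : L) : ℝ :=
  if h : (groupUsers net k l).Nonempty then (groupUsers net k l).sup' h x else 0

/-- Feasible rate vectors: nonnegative, and on each link the sum over the groups using it of the
maximal rate in the group is at most the capacity. -/
def Feasible (x : N → ℝ) : Prop :=
  (∀ i, 0 ≤ x i) ∧ ∀ l, ∑ k ∈ linkGroups net l, groupMax net x k l ≤ net.cap l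

/-- `x` solves the welfare maximisation problem. -/
def IsSolution (v : N → ℝ → ℝ) (x : N → ℝ) : Prop :=
  Feasible net x ∧ ∀ x', Feasible net x' → ∑ i, v i (x' i) ≤ ∑ i, v i (x i)

end Problem

/-- The message graph: a tree on the set of agents, a choice `Φ i` of a neighbour for every agent,
and for every link `l` and every group `k` using `l` an agent `center k l` (irrelevant for other
pairs), such that the users of each link induce a connected subgraph and `center k l` is a user of
`l` in group `k` that is adjacent to all other users of `l` in group `k`. -/
structure MessageGraph {N L K : Type*} [Fintype N] [Fintype L] [Fintype K]
    (net : Network N L K) where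
  graph : SimpleGraph N
  isTree : graph.IsTree
  Φ : N → N
  adj_Φ : ∀ i, graph.Adj i (Φ i)
  users_connected : ∀ l, (graph.induce {i | i ∈ users net l}).Connected
  center : K → L → N
  center_mem : ∀ l, ∀ k ∈ linkGroups net l, center k l ∈ groupUsers net k l
  center_adj : ∀ l, ∀ k ∈ linkGroups net l, ∀ j ∈ groupUsers net k l,
    j ≠ center k l → graph.Adj (center k l) j

/-- A message `(y, y̲, n, q, (¹p, ²p), w, (¹z, ²z), (¹a, ²a))`.  All component families are indexed
by the full sets of agents and links; `messageSpace` requires the components outside the index sets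
of the respective agent to be zero. -/
structure Message (N L : Type*) where
  y : ℝ
  ylow : L → ℝ
  n : N → L → ℝ
  q : N → ℝ
  p1 : L → ℝ
  p2 : N → L → ℝ
  w : L → ℝ
  z1 : L → ℝ
  z2 : L → ℝ
  a1 : L → ℝ
  a2 : N → L → ℝ

/-- `g` is a vector of nonnegative reals indexed by `S`, extended by zero outside `S`. -/
def NonnegOn {α : Type*} (S : α → Prop) (g : α → ℝ) : Prop :=
  ∀ a, 0 ≤ g a ∧ (¬ S a → g a = 0)

/-- `g` is a vector of positive reals indexed by `S`, extended by zero outside `S`. -/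
def PosOn {α : Type*} (S : α → Prop) (g : α → ℝ) : Prop :=
  ∀ a, (S a → 0 < g a) ∧ (¬ S a → g a = 0)

section Mechanism

variable {N L K : Type*} [Fintype N] [Fintype L] [Fintype K] {net : Network N L K}
  (G : MessageGraph net)

open Classical in
/-- The neighbours of agent `i` in the message graph. -/
def nbrs (i : N) : Finset N := Finset.univ.filter fun j => G.graph.Adj i j

open Classical in
/-- The neighbours of agent `i` that use link `l`. -/
def linkNbrs (i : N) (l : L) : Finset N := (nbrs G i).filter fun j => l ∈ net.route j

open Classical in
/-- The neighbours `h` of agent `i` with `Φ h = i`. -/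
def clients (i : N) : Finset N := (nbrs G i).filter fun h => G.Φ h = i

open Classical in
/-- The links for which agent `i` is the center of its own group. -/
def centerLinks (i : N) : Finset L :=
  (net.route i).filter fun l => G.center (net.group i) l = i

/-- The message space of agent `i`. -/
def messageSpace (i : N) : Set (Message N L) :=
  {μ | 0 ≤ μ.y ∧
    NonnegOn (fun l => l ∈ net.route i) μ.ylow ∧
    NonnegOn (fun jl : N × L => jl.1 ∈ nbrs G i) (fun jl => μ.n jl.1 jl.2) ∧
    NonnegOn (fun j => j ∈ clients G i) μ.q ∧
    NonnegOn (fun l => l ∈ net.route i) μ.p1 ∧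
    NonnegOn (fun jl : N × L => jl.1 ∈ clients G i ∧ jl.2 ∈ net.route jl.1)
      (fun jl => μ.p2 jl.1 jl.2) ∧
    NonnegOn (fun l => l ∈ net.route i) μ.w ∧
    NonnegOn (fun l => l ∈ centerLinks G i) μ.z1 ∧
    NonnegOn (fun l => l ∈ centerLinks G i) μ.z2 ∧
    PosOn (fun l => l ∈ net.route i) μ.a1 ∧
    PosOn (fun jl : N × L => jl.1 ∈ clients G i ∧ jl.2 ∈ net.route jl.1)
      (fun jl => μ.a2 jl.1 jl.2)}

/-- A message profile in the product of the message spaces. -/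
def IsProfile (m : N → Message N L) : Prop := ∀ i, m i ∈ messageSpace G i

variable (m : N → Message N L)

/-- The proxy for the demand of agent `i` that is quoted by `Φ i`. -/
def proxyDemand (i : N) : ℝ := (m (G.Φ i)).q i

/-- The price for link `l` that `Φ i` quotes for agent `i`. -/
def proxyPrice (i : N) (l : L) : ℝ := (m (G.Φ i)).p2 i l

open Classical in
/-- The other users of link `l` in the group of agent `i`. -/
def peers (net : Network N L K) (i : N) (l : L) : Finset N :=
  (groupUsers net (net.group i) l).erase i

open Classical in
/-- `¹z̄`: the maximal demand in the group of `i` on link `l`, as seen by `i` (for `l ∈ route i`).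
At a center it is the maximum of the proxy demand of `i` and of the demands of its peers. -/
def zbar1 (i : N) (l : L) : ℝ :=
  if l ∈ centerLinks G i then
    (peers net i l).fold max (proxyDemand G m i) fun j => (m j).y
  else (m (G.center (net.group i) l)).z1 l

open Classical in
/-- `²z̄`: the number of agents with maximal demand in the group of `i` on link `l`, as seen
by `i` (for `l ∈ route i`). -/
def zbar2 (i : N) (l : L) : ℝ :=
  if l ∈ centerLinks G i then
    (if zbar1 G m i l = proxyDemand G m i then 1 else 0) +
      ∑ j ∈ peers net i l, (if zbar1 G m i l = (m j).y then 1 else 0)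
  else (m (G.center (net.group i) l)).z2 l

open Classical in
/-- The share of agent `i` (for `l ∈ route i`) in the demand of its group on link `l`. -/
def share (i : N) (l : L) : ℝ :=
  proxyDemand G m i * (if zbar1 G m i l = proxyDemand G m i then 1 else 0) / zbar2 G m i l

open Classical in
/-- The part of the load of link `l` that neighbour `j` reports to agent `i`. -/
def report (i j : N) (l : L) : ℝ :=
  (m j).ylow l + ∑ h ∈ (nbrs G j).erase i, (m j).n h l

open Classical in
/-- `f`: the load of link `l` as seen by agent `i`. -/
def load (i : N) (l : L) : ℝ :=
  (if l ∈ net.route i then share G m i l else 0) + ∑ j ∈ nbrs G i, report G m i j l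

open Classical in
/-- The radial allocation factor: the minimum of `cap l / load l` over the links, where a link with
zero load imposes no restriction (its ratio is `+∞`).  If all loads seen by `i` are zero, the
minimum is not a real number and the factor is the given number `r₀ i`. -/
def radial (r₀ : N → ℝ) (i : N) : ℝ :=
  if h : (Finset.univ.filter fun l => 0 < load G m i l).Nonempty then
    (Finset.univ.filter fun l => 0 < load G m i l).inf' h fun l => net.cap l / load G m i l
  else r₀ i

/-- The allocation function. -/
def alloc (r₀ : N → ℝ) (i : N) : ℝ := radial G m r₀ i * (m i).y

open Classical in
/-- `ŵ`, for `l ∈ route i`. -/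
def what (i : N) (l : L) : ℝ :=
  (if l ∈ centerLinks G i then ∑ j ∈ groupUsers net (net.group i) l, (m j).p1 l
    else (m (G.center (net.group i) l)).w l - proxyPrice G m i l + (m i).p1 l) +
  ((m i).a1 l - (m (G.Φ i)).a2 i l)

/-- `w̄`: the average of the group prices quoted by the neighbours of `i` using link `l`. -/
def wbar (i : N) (l : L) : ℝ :=
  (1 / ((linkNbrs G i l).card : ℝ)) * ∑ j ∈ linkNbrs G i l, (m j).w l

/-- The consensus part of the tax. -/
def taxConsensus (i : N) : ℝ :=
  ∑ j ∈ clients G i, ∑ l ∈ net.route j,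
      (((m i).p2 j l - (m j).p1 l) ^ 2 + ((m i).a2 j l - (m j).a1 l) ^ 2) +
    ∑ j ∈ clients G i, ((m i).q j - (m j).y) ^ 2

/-- The tax term for the summary messages, present for all links. -/
def taxSummary (i : N) (l : L) : ℝ :=
  ∑ j ∈ nbrs G i, ((m i).n j l - report G m i j l) ^ 2

/-- The tax terms that are common to all agents using the link. -/
def taxUser (r₀ : N → ℝ) (i : N) (l : L) : ℝ :=
  proxyPrice G m i l * alloc G m r₀ i +
    ((m i).ylow l - share G m i l) ^ 2 +
    wbar G m i l * (what G m i l - wbar G m i l) *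
      (net.cap l - radial G m r₀ i * load G m i l) ^ 2 +
    (what G m i l - wbar G m i l) ^ 2 +
    proxyPrice G m i l * ((m i).p1 l - proxyPrice G m i l) *
      (zbar1 G m i l - proxyDemand G m i) ^ 2

open Classical in
/-- The tax terms that differ between centers and other agents using the link. -/
def taxRole (i : N) (l : L) : ℝ :=
  if l ∈ centerLinks G i then
    ((m i).z1 l - zbar1 G m i l) ^ 2 + ((m i).z2 l - zbar2 G m i l) ^ 2 +
      ((m i).w l - proxyPrice G m i l - ∑ j ∈ peers net i l, (m j).p1 l) ^ 2
  else ((m i).w l - (m (G.center (net.group i) l)).w l) ^ 2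

open Classical in
/-- The tax component of agent `i` for link `l`. -/
def taxLink (r₀ : N → ℝ) (i : N) (l : L) : ℝ :=
  taxSummary G m i l +
    if l ∈ net.route i then taxUser G m r₀ i l + taxRole G m i l else 0

/-- The tax function. -/
def tax (r₀ : N → ℝ) (i : N) : ℝ :=
  taxConsensus G m i + ∑ l, taxLink G m r₀ i l

/-- The utility of agent `i` in the induced game. -/
def utility (v : N → ℝ → ℝ) (r₀ : N → ℝ) (i : N) : ℝ :=
  v i (alloc G m r₀ i) - tax G m r₀ i

open Classical in
/-- `m` is a (pure) Nash equilibrium of the induced game. -/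
def IsNash (v : N → ℝ → ℝ) (r₀ : N → ℝ) : Prop :=
  IsProfile G m ∧ ∀ i, ∀ μ ∈ messageSpace G i,
    utility G (Function.update m i μ) v r₀ i ≤ utility G m v r₀ i

end Mechanism

end Multicast

end

/-! The mechanism is a decentralised form of the KKT conditions of the welfare problem, and
`Supports` is that KKT system: individual prices `p` that add up to a common link price `w` within
every group, complementary slackness for both, and price-taking optimality of each agent.
`Supports.isSolution` and `Supports.eq_of_isSolution` show by weak duality and strict concavity that
a supported rate vector is the unique solution. `IsSolution.exists_supports` obtains prices for a
solution from Lagrange multipliers.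

Everything that enters the payoff of `i` besides its own message, including the radial factor,
depends only on messages of its neighbours. So the payoff separates (`tax_eq`, `utility_update`)
into a sum of squares `mismatch`, a part in `y`, and for each link an `adjustment` in `¹p` and `¹a`.

At an equilibrium the mismatch vanishes, since the suggested values may always be sent. Proxies are
then exact, and the summaries, propagated along the tree, show every agent the true load
(`load_eq`). Optimality in `y` is price-taking behaviour. Optimality in `¹a` bounds each quoted
group price by the average of the neighbours' quotes. A maximum principle makes the quotes equal,
and the same condition then becomes complementary slackness for the link. Trading `¹p` against `¹a`
gives complementary slackness within the group. Hence the allocation is supported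
(`IsNash.exists_supports`), and each tax is prices times allocation. Conversely, supporting prices
yield an equilibrium (`Supports.isNash`). -/

namespace Multicast

/-! ### Convex duality and monotonicity of valuations -/

open Set in
/-- Lagrange multipliers for a concave program with finitely many convex constraints that satisfies
Slater's condition. -/
theorem exists_multipliers {E σ : Type*} [AddCommGroup E] [Module ℝ E] [Fintype σ]
    {C : Set E} {F : E → ℝ} (hF : ConcaveOn ℝ C F) {g : σ → E → ℝ}
    (hg : ∀ s, ConvexOn ℝ C (g s)) {x₀ : E} (hx₀ : x₀ ∈ C) (hslater : ∀ s, g s x₀ < 0)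
    {b : ℝ} (hb : ∀ x ∈ C, (∀ s, g s x ≤ 0) → F x ≤ b) :
    ∃ lam : σ → ℝ, (∀ s, 0 ≤ lam s) ∧ ∀ x ∈ C, F x - ∑ s, lam s * g s x ≤ b := by
  classical
  -- The strict hypograph of the value function under perturbed constraints. It is open, convex and
  -- misses `(0, b)`, so a hyperplane separates it from that point, and the normal gives the
  -- multipliers.
  let A : Set ((σ → ℝ) × ℝ) := {p | ∃ x ∈ C, (∀ s, g s x < p.1 s) ∧ p.2 < F x}
  have hconv : Convex ℝ A := by
    rintro p ⟨x, hx, hxg, hxF⟩ q ⟨y, hy, hyg, hyF⟩ a c ha hc hac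
    refine ⟨a • x + c • y, hF.1 hx hy ha hc hac, fun s => ?_, ?_⟩
    · have h1 := (hg s).2 hx hy ha hc hac
      have h2 := hxg s
      have h3 := hyg s
      simp only [smul_eq_mul, Prod.fst_add, Prod.smul_fst, Pi.add_apply, Pi.smul_apply] at h1 ⊢
      rcases ha.eq_or_lt with rfl | ha'
      · have : c = 1 := by linarith
        subst this; linarith
      · nlinarith [mul_le_mul_of_nonneg_left h3.le hc, mul_lt_mul_of_pos_left h2 ha']
    · have h1 := hF.2 hx hy ha hc hac
      simp only [smul_eq_mul, Prod.snd_add, Prod.smul_snd] at h1 ⊢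
      rcases ha.eq_or_lt with rfl | ha'
      · have : c = 1 := by linarith
        subst this; linarith
      · nlinarith [mul_le_mul_of_nonneg_left hyF.le hc, mul_lt_mul_of_pos_left hxF ha']
  have hopen : IsOpen A := by
    have : A = ⋃ x ∈ C, {p : (σ → ℝ) × ℝ | (∀ s, g s x < p.1 s) ∧ p.2 < F x} := by
      ext p
      simp only [mem_iUnion, exists_prop]
      rfl
    rw [this]
    refine isOpen_biUnion fun x _ => ?_
    have h1 : IsOpen {p : (σ → ℝ) × ℝ | ∀ s, g s x < p.1 s} := by
      simp only [ofPred_forall]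
      exact isOpen_iInter_of_finite fun s =>
        isOpen_lt continuous_const ((continuous_apply s).comp continuous_fst)
    exact h1.inter (isOpen_lt continuous_snd continuous_const)
  have hnot : ((0 : σ → ℝ), b) ∉ A := by
    rintro ⟨x, hx, hxg, hxF⟩
    exact absurd (hb x hx fun s => (hxg s).le) (not_le.2 hxF)
  obtain ⟨f, hf⟩ := geometric_hahn_banach_open_point hconv hopen hnot
  let e : σ → ℝ := fun s => f (Pi.single s 1, 0)
  let μ : ℝ := f (0, 1)
  have hrep : ∀ u t, f (u, t) = ∑ s, u s * e s + t * μ := by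
    intro u t
    have h1 : ((u, t) : (σ → ℝ) × ℝ) =
        ∑ s, u s • ((Pi.single s 1, 0) : (σ → ℝ) × ℝ) + t • ((0, 1) : (σ → ℝ) × ℝ) := by
      refine Prod.ext ?_ ?_
      · ext s'
        simp [Prod.fst_sum, Finset.sum_apply, Pi.single_apply]
      · simp [Prod.snd_sum]
    rw [h1]
    simp only [map_add, map_sum, map_smul, smul_eq_mul, e, μ]
  have hmem : ∀ x ∈ C, ∀ ε > 0, ∀ δ : σ → ℝ, (∀ s, 0 < δ s) →
      ∑ s, (g s x + δ s) * e s + (F x - ε) * μ < b * μ := by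
    intro x hx ε hε δ hδ
    have h := hf (fun s => g s x + δ s, F x - ε)
      ⟨x, hx, fun s => by simpa using hδ s, by simpa using hε⟩
    rw [hrep, hrep] at h
    simpa using h
  have hlin : ∀ x ∈ C, ∑ s, g s x * e s + F x * μ ≤ b * μ := by
    intro x hx
    refine le_of_forall_pos_lt_add fun η hη => ?_
    -- Moving every coordinate by `η / B` changes the functional by at most `η`.
    let B := ∑ s, |e s| + |μ| + 1
    have hB : 0 < B := by positivity
    have h := hmem x hx (η / B) (by positivity) (fun _ => η / B) (fun _ => by positivity)
    have h2 : -(∑ s, |e s|) ≤ ∑ s, e s := by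
      rw [← Finset.sum_neg_distrib]
      exact Finset.sum_le_sum fun s _ => neg_abs_le _
    have h3 : ∑ s, (g s x + η / B) * e s = ∑ s, g s x * e s + η / B * ∑ s, e s := by
      rw [Finset.mul_sum, ← Finset.sum_add_distrib]
      exact Finset.sum_congr rfl fun s _ => by ring
    rw [h3] at h
    have h4 : η / B * (∑ s, e s - μ) ≥ η / B * (-B) := by
      refine mul_le_mul_of_nonneg_left ?_ (by positivity)
      simp only [B]; linarith [le_abs_self μ]
    have h5 : η / B * (-B) = -η := by field_simp
    nlinarith
  -- `A` is unbounded upwards in each constraint coordinate, so a positive coefficient would violate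
  -- the separating bound.
  have he : ∀ s, e s ≤ 0 := by
    intro s
    by_contra! hpos
    have key : ∀ M : ℝ, 0 < M → ∑ s', (g s' x₀ + 1) * e s' + M * e s + (F x₀ - 1) * μ < b * μ := by
      intro M hM
      have h := hmem x₀ hx₀ 1 one_pos (fun s' => 1 + if s' = s then M else 0)
        (fun s' => by split_ifs <;> linarith)
      have h3 : ∑ s', (g s' x₀ + (1 + if s' = s then M else 0)) * e s' =
          ∑ s', (g s' x₀ + 1) * e s' + M * e s := by
        simp only [← add_assoc, add_mul _ (ite _ _ _), Finset.sum_add_distrib, ite_mul, zero_mul,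
          Finset.sum_ite_eq', Finset.mem_univ, if_true]
      rwa [h3] at h
    set a := ∑ s', (g s' x₀ + 1) * e s'
    have h := key ((|b * μ - a - (F x₀ - 1) * μ| + 1) / e s) (by positivity)
    rw [div_mul_cancel₀ _ hpos.ne'] at h
    linarith [le_abs_self (b * μ - a - (F x₀ - 1) * μ)]
  -- Slater's condition excludes a vertical hyperplane: `A` contains a point with constraint part
  -- `0` and value below `b`.
  have hμ : 0 < μ := by
    have h1 := hf (0, min b (F x₀) - 1) ⟨x₀, hx₀, hslater, by
      have := min_le_right b (F x₀)
      simp only; linarith⟩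
    rw [hrep, hrep] at h1
    simp only [Pi.zero_apply, zero_mul, Finset.sum_const_zero, zero_add] at h1
    have := min_le_left b (F x₀)
    by_contra! hneg
    nlinarith
  refine ⟨fun s => -e s / μ, fun s => div_nonneg (by linarith [he s]) hμ.le, fun x hx => ?_⟩
  have h := hlin x hx
  have h3 : ∑ s, -e s / μ * g s x = -(∑ s, g s x * e s) / μ := by
    rw [← Finset.sum_neg_distrib, Finset.sum_div]
    exact Finset.sum_congr rfl fun s _ => by ring
  rw [h3, neg_div, sub_neg_eq_add, ← mul_le_mul_iff_left₀ hμ, add_mul, div_mul_cancel₀ _ hμ.ne']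
  linarith

/-- If two values agreed, strict concavity would put the midpoint above the value at the right end,
against monotonicity. -/
theorem IsValuation.strictMonoOn {v : ℝ → ℝ} (hv : IsValuation v) :
    StrictMonoOn v (Set.Ici 0) := by
  intro x hx y hy hxy
  refine lt_of_le_of_ne (hv.monotone hx hy hxy.le) fun heq => ?_
  have hx0 : 0 ≤ x := hx
  have hy0 : 0 ≤ y := hy
  have h := hv.strictConcave.2 hx hy hxy.ne one_half_pos one_half_pos (add_halves 1)
  have h2 := hv.monotone (a := (1 / 2 : ℝ) • x + (1 / 2 : ℝ) • y) (b := y)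
    (by simp only [smul_eq_mul, Set.mem_Ici]; linarith) hy (by simp only [smul_eq_mul]; linarith)
  simp only [smul_eq_mul] at h h2
  linarith

/-! ### The welfare problem and its supporting prices -/

section Problem

variable {N L K : Type*} [Fintype N] [Fintype L] [Fintype K] {net : Network N L K}

theorem mem_users {i : N} {l : L} : i ∈ users net l ↔ l ∈ net.route i := by
  simp [users]

theorem mem_groupUsers {i : N} {k : K} {l : L} :
    i ∈ groupUsers net k l ↔ l ∈ net.route i ∧ net.group i = k := by
  simp [groupUsers, mem_users]

theorem mem_linkGroups {k : K} {l : L} :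
    k ∈ linkGroups net l ↔ ∃ i, l ∈ net.route i ∧ net.group i = k := by
  simp [linkGroups, mem_users]

theorem group_mem_linkGroups {i : N} {l : L} (h : l ∈ net.route i) :
    net.group i ∈ linkGroups net l := mem_linkGroups.2 ⟨i, h, rfl⟩

theorem groupUsers_nonempty {k : K} {l : L} (h : k ∈ linkGroups net l) :
    (groupUsers net k l).Nonempty := by
  obtain ⟨i, hi⟩ := mem_linkGroups.1 h
  exact ⟨i, mem_groupUsers.2 hi⟩

theorem linkGroups_nonempty (net : Network N L K) (l : L) : (linkGroups net l).Nonempty := by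
  obtain ⟨i, -, hi, -⟩ := net.two_groups l
  exact ⟨_, group_mem_linkGroups hi⟩

theorem le_groupMax (x : N → ℝ) {i : N} {k : K} {l : L} (h : i ∈ groupUsers net k l) :
    x i ≤ groupMax net x k l := by
  rw [groupMax, dif_pos ⟨i, h⟩]
  exact Finset.le_sup' x h

theorem groupMax_le {x : N → ℝ} {k : K} {l : L} {b : ℝ} (hb : 0 ≤ b)
    (h : ∀ i ∈ groupUsers net k l, x i ≤ b) : groupMax net x k l ≤ b := by
  rw [groupMax]
  split_ifs with hne
  · exact Finset.sup'_le hne x h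
  · exact hb

theorem groupMax_nonneg {x : N → ℝ} (hx : ∀ i, 0 ≤ x i) (k : K) (l : L) :
    0 ≤ groupMax net x k l := by
  rw [groupMax]
  split_ifs with hne
  · obtain ⟨i, hi⟩ := hne
    exact (hx i).trans (Finset.le_sup' x hi)
  · exact le_rfl

theorem exists_eq_groupMax (x : N → ℝ) {k : K} {l : L} (h : k ∈ linkGroups net l) :
    ∃ i ∈ groupUsers net k l, groupMax net x k l = x i := by
  rw [groupMax, dif_pos (groupUsers_nonempty h)]
  exact Finset.exists_mem_eq_sup' _ x

theorem groupMax_mul {x : N → ℝ} {r : ℝ} (hr : 0 ≤ r) {k : K} {l : L} (h : k ∈ linkGroups net l) :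
    groupMax net (fun i => r * x i) k l = r * groupMax net x k l := by
  obtain ⟨i, hi, hix⟩ := exists_eq_groupMax x h
  obtain ⟨j, hj, hjx⟩ := exists_eq_groupMax (fun i => r * x i) h
  apply le_antisymm
  · rw [hjx]
    exact mul_le_mul_of_nonneg_left (le_groupMax x hj) hr
  · rw [hix]
    exact le_groupMax (fun i => r * x i) hi

theorem continuous_groupMax (k : K) (l : L) : Continuous fun x : N → ℝ => groupMax net x k l := by
  by_cases h : (groupUsers net k l).Nonempty
  · simp only [groupMax, dif_pos h]
    exact Continuous.finset_sup'_apply h fun i _ => continuous_apply i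
  · simp only [groupMax, dif_neg h]
    exact continuous_const

theorem Feasible.le_cap {x : N → ℝ} (hx : Feasible net x) {i : N} {l : L} (h : l ∈ net.route i) :
    x i ≤ net.cap l :=
  calc x i ≤ groupMax net x (net.group i) l := le_groupMax x (mem_groupUsers.2 ⟨h, rfl⟩)
    _ ≤ ∑ k ∈ linkGroups net l, groupMax net x k l :=
      Finset.single_le_sum (f := fun k => groupMax net x k l)
        (fun k _ => groupMax_nonneg hx.1 k l) (group_mem_linkGroups h)
    _ ≤ net.cap l := hx.2 l

theorem sum_users_eq (l : L) (f : N → ℝ) :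
    ∑ i ∈ users net l, f i = ∑ k ∈ linkGroups net l, ∑ i ∈ groupUsers net k l, f i := by
  classical
  rw [← Finset.sum_fiberwise_of_maps_to (g := net.group) (t := linkGroups net l)
    (fun i hi => group_mem_linkGroups (mem_users.1 hi)) f]
  refine Finset.sum_congr rfl fun k _ => Finset.sum_congr ?_ fun _ _ => rfl
  ext i
  simp [groupUsers]

theorem sum_route_eq (f : N → L → ℝ) :
    ∑ i, ∑ l ∈ net.route i, f i l = ∑ l, ∑ i ∈ users net l, f i l :=
  Finset.sum_comm' fun i l => by simp [mem_users]

/-- The prices `p` (for individual agents) and `w` (for groups) support the rate vector `x`. -/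
structure Supports (net : Network N L K) (v : N → ℝ → ℝ) (x : N → ℝ) (p : N → L → ℝ)
    (w : L → ℝ) : Prop where
  feasible : Feasible net x
  nonneg : ∀ i l, l ∈ net.route i → 0 ≤ p i l
  sum_eq : ∀ l, ∀ k ∈ linkGroups net l, ∑ i ∈ groupUsers net k l, p i l = w l
  slack : ∀ l, w l * (net.cap l - ∑ k ∈ linkGroups net l, groupMax net x k l) = 0
  top : ∀ i l, l ∈ net.route i → p i l * (groupMax net x (net.group i) l - x i) = 0
  opt : ∀ i t, 0 ≤ t →
    v i t - (∑ l ∈ net.route i, p i l) * t ≤ v i (x i) - (∑ l ∈ net.route i, p i l) * x i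

namespace Supports

variable {v : N → ℝ → ℝ} {x : N → ℝ} {p : N → L → ℝ} {w : L → ℝ}

theorem w_nonneg (h : Supports net v x p w) (l : L) : 0 ≤ w l := by
  obtain ⟨k, hk⟩ := linkGroups_nonempty net l
  rw [← h.sum_eq l k hk]
  exact Finset.sum_nonneg fun i hi => h.nonneg i l (mem_groupUsers.1 hi).1

/-- Weak duality: replace each rate by its group maximum. The prices of every group add up to the
same `w l`, so only the capacity constraint remains. -/
theorem payment_le (h : Supports net v x p w) {x' : N → ℝ} (hx' : Feasible net x') :
    ∑ i, (∑ l ∈ net.route i, p i l) * x' i ≤ ∑ l, w l * net.cap l := by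
  simp only [Finset.sum_mul]
  rw [sum_route_eq fun i l => p i l * x' i]
  refine Finset.sum_le_sum fun l _ => ?_
  rw [sum_users_eq]
  calc _ ≤ ∑ k ∈ linkGroups net l, ∑ i ∈ groupUsers net k l, p i l * groupMax net x' k l :=
        Finset.sum_le_sum fun k _ => Finset.sum_le_sum fun i hi =>
          mul_le_mul_of_nonneg_left (le_groupMax x' hi) (h.nonneg i l (mem_groupUsers.1 hi).1)
    _ = w l * ∑ k ∈ linkGroups net l, groupMax net x' k l := by
        rw [Finset.mul_sum]
        exact Finset.sum_congr rfl fun k hk => by rw [← Finset.sum_mul, h.sum_eq l k hk]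
    _ ≤ _ := mul_le_mul_of_nonneg_left (hx'.2 l) (h.w_nonneg l)

/-- The two complementary slackness conditions turn both estimates of `payment_le` into equalities.
-/
theorem payment_eq (h : Supports net v x p w) :
    ∑ i, (∑ l ∈ net.route i, p i l) * x i = ∑ l, w l * net.cap l := by
  simp only [Finset.sum_mul]
  rw [sum_route_eq fun i l => p i l * x i]
  refine Finset.sum_congr rfl fun l _ => ?_
  rw [sum_users_eq]
  calc _ = ∑ k ∈ linkGroups net l, ∑ i ∈ groupUsers net k l, p i l * groupMax net x k l := by
        refine Finset.sum_congr rfl fun k _ => Finset.sum_congr rfl fun i hi => ?_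
        obtain ⟨hil, rfl⟩ := mem_groupUsers.1 hi
        linarith [h.top i l hil]
    _ = w l * ∑ k ∈ linkGroups net l, groupMax net x k l := by
        rw [Finset.mul_sum]
        exact Finset.sum_congr rfl fun k hk => by rw [← Finset.sum_mul, h.sum_eq l k hk]
    _ = _ := by linarith [h.slack l]

theorem isSolution (h : Supports net v x p w) : IsSolution net v x := by
  refine ⟨h.feasible, fun x' hx' => ?_⟩
  have h1 := Finset.sum_le_sum fun i (_ : i ∈ Finset.univ) => h.opt i (x' i) (hx'.1 i)
  simp only [Finset.sum_sub_distrib] at h1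
  linarith [h.payment_le hx', h.payment_eq]

/-- Summing `opt` shows that another solution also consists of price-taking optima of all agents. If
it differed in one coordinate, the midpoint would be strictly better there. -/
theorem eq_of_isSolution (h : Supports net v x p w) (hv : ∀ i, IsValuation (v i)) {x' : N → ℝ}
    (hx' : IsSolution net v x') : x' = x := by
  have h1 : ∀ i ∈ Finset.univ, _ := fun i _ => h.opt i (x' i) (hx'.1.1 i)
  have h2 := hx'.2 x h.feasible
  have h3 : ∑ i, (v i (x' i) - (∑ l ∈ net.route i, p i l) * x' i) =
      ∑ i, (v i (x i) - (∑ l ∈ net.route i, p i l) * x i) := by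
    refine le_antisymm (Finset.sum_le_sum h1) ?_
    simp only [Finset.sum_sub_distrib]
    linarith [h.payment_le hx'.1, h.payment_eq]
  rw [Finset.sum_eq_sum_iff_of_le h1] at h3
  ext i
  by_contra hne
  have h4 := h3 i (Finset.mem_univ i)
  have hx0 := h.feasible.1 i
  have hx0' := hx'.1.1 i
  have h5 := (hv i).strictConcave.2 hx0' hx0 hne one_half_pos one_half_pos
    (add_halves 1)
  have h6 := h.opt i ((1 / 2 : ℝ) • x' i + (1 / 2 : ℝ) • x i)
    (by simp only [smul_eq_mul]; linarith)
  simp only [smul_eq_mul] at h5 h6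
  nlinarith

/-- The prices of an agent do not all vanish, as its valuation has no maximum. -/
theorem price_pos (h : Supports net v x p w) (hv : ∀ i, IsValuation (v i)) (i : N) :
    ∃ l ∈ net.route i, 0 < p i l := by
  by_contra! hcon
  have h0 : ∑ l ∈ net.route i, p i l = 0 :=
    Finset.sum_eq_zero fun l hl => le_antisymm (hcon l hl) (h.nonneg i l hl)
  have h1 := h.opt i (x i + 1) (by linarith [h.feasible.1 i])
  have h2 := (hv i).strictMonoOn (a := x i) (b := x i + 1) (h.feasible.1 i)
    (by simp only [Set.mem_Ici]; linarith [h.feasible.1 i]) (by linarith)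
  rw [h0] at h1
  linarith

theorem exists_tight (h : Supports net v x p w) (hv : ∀ i, IsValuation (v i)) (i : N) :
    ∃ l, ∑ k ∈ linkGroups net l, groupMax net x k l = net.cap l := by
  obtain ⟨l, hl, hp⟩ := h.price_pos hv i
  refine ⟨l, ?_⟩
  have hw : 0 < w l := by
    rw [← h.sum_eq l _ (group_mem_linkGroups hl)]
    exact hp.trans_le (Finset.single_le_sum (f := fun i => p i l)
      (fun j hj => h.nonneg j l (mem_groupUsers.1 hj).1) (mem_groupUsers.2 ⟨hl, rfl⟩))
  have := (mul_eq_zero.1 (h.slack l)).resolve_left hw.ne'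
  linarith

end Supports

/-- The feasible set is compact: each agent uses some link, whose capacity bounds its rate. -/
theorem exists_isSolution (net : Network N L K) {v : N → ℝ → ℝ} (hv : ∀ i, IsValuation (v i)) :
    ∃ x, IsSolution net v x := by
  have hcomp : IsCompact {x | Feasible net x} := by
    choose l hl using net.route_nonempty
    refine (isCompact_Icc (a := (0 : N → ℝ)) (b := fun i => net.cap (l i))).of_isClosed_subset ?_ ?_
    · have : {x | Feasible net x} = {x : N → ℝ | ∀ i, 0 ≤ x i} ∩
          {x | ∀ l, ∑ k ∈ linkGroups net l, groupMax net x k l ≤ net.cap l} := rfl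
      rw [this]
      simp only [Set.ofPred_forall]
      refine IsClosed.inter (isClosed_iInter fun i => ?_) (isClosed_iInter fun l => ?_)
      · exact isClosed_le continuous_const (continuous_apply i)
      · exact isClosed_le (continuous_finsetSum _ fun k _ => continuous_groupMax k l)
          continuous_const
    · exact fun x hx => ⟨fun i => hx.1 i, fun i => Feasible.le_cap hx (hl i)⟩
  have hne : {x | Feasible net x}.Nonempty := by
    refine ⟨0, fun i => le_rfl, fun l => ?_⟩
    refine (Finset.sum_nonpos fun k _ => ?_).trans (net.cap_pos l).le
    exact groupMax_le le_rfl fun i _ => le_rfl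
  have hcont : ContinuousOn (fun x : N → ℝ => ∑ i, v i (x i)) {x | Feasible net x} :=
    continuousOn_finsetSum _ fun i _ =>
      (hv i).contDiff.continuousOn.comp (continuous_apply i).continuousOn fun x hx => hx.1 i
  obtain ⟨x, hx, hmax⟩ := hcomp.exists_isMaxOn hne hcont
  exact ⟨x, hx, fun x' hx' => hmax hx'⟩

open Classical in
theorem IsSolution.exists_supports {v : N → ℝ → ℝ} (hv : ∀ i, IsValuation (v i)) {x : N → ℝ}
    (hx : IsSolution net v x) : ∃ p w, Supports net v x p w := by
  -- The group maxima become free variables `z k l` with linear constraints `x i ≤ z k l` and `∑ z k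
  -- l ≤ cap l`; their multipliers are `p` and `w`. Pairs `(i, l)` off the route get the constant
  -- `-1`, which never binds and keeps Slater's condition.
  let C : Set ((N → ℝ) × (K → L → ℝ)) := {z | ∀ i, 0 ≤ z.1 i}
  let F : (N → ℝ) × (K → L → ℝ) → ℝ := fun z => ∑ i, v i (z.1 i)
  let g : (N × L) ⊕ L → (N → ℝ) × (K → L → ℝ) → ℝ := fun s z => s.elim
    (fun il => if il.2 ∈ net.route il.1 then z.1 il.1 - z.2 (net.group il.1) il.2 else -1)
    (fun l => ∑ k ∈ linkGroups net l, z.2 k l - net.cap l)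
  have hC : Convex ℝ C := by
    intro y hy z hz a b ha hb _ i
    exact add_nonneg (mul_nonneg ha (hy i)) (mul_nonneg hb (hz i))
  have hF : ConcaveOn ℝ C F := by
    refine ⟨hC, fun y hy z hz a b ha hb hab => ?_⟩
    simp only [F, smul_eq_mul, Finset.mul_sum, ← Finset.sum_add_distrib]
    exact Finset.sum_le_sum fun i _ => (hv i).strictConcave.concaveOn.2 (hy i) (hz i) ha hb hab
  have hg : ∀ s, ConvexOn ℝ C (g s) := by
    refine fun s => ⟨hC, fun y _ z _ a b _ _ hab => le_of_eq ?_⟩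
    obtain rfl : b = 1 - a := by linarith
    rcases s with ⟨i, l⟩ | l
    · by_cases h : l ∈ net.route i <;> simp [g, h] <;> ring
    · simp only [g, Sum.elim_inr, Prod.snd_add, Prod.smul_snd, Pi.add_apply, Pi.smul_apply,
        smul_eq_mul, Finset.sum_add_distrib, ← Finset.mul_sum]
      ring
  let z₀ : (N → ℝ) × (K → L → ℝ) := (0, fun _ l => net.cap l / ((linkGroups net l).card + 1))
  have hslater : ∀ s, g s z₀ < 0 := by
    rintro (⟨i, l⟩ | l)
    · have := net.cap_pos l
      by_cases h : l ∈ net.route i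
      · simp only [g, h, z₀, Sum.elim_inl, if_true, Pi.zero_apply, zero_sub, neg_lt_zero]
        positivity
      · simp [g, h]
    · have := net.cap_pos l
      simp only [g, z₀, Sum.elim_inr, Finset.sum_const, nsmul_eq_mul, sub_neg]
      rw [mul_div_assoc', div_lt_iff₀ (by positivity)]
      linarith
  have hb : ∀ z ∈ C, (∀ s, g s z ≤ 0) → F z ≤ ∑ i, v i (x i) := by
    intro z hz hgz
    refine hx.2 z.1 ⟨hz, fun l => ?_⟩
    refine le_trans (Finset.sum_le_sum fun k hk => ?_) (sub_nonpos.1 (hgz (Sum.inr l)))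
    obtain ⟨i, hi, hix⟩ := exists_eq_groupMax z.1 hk
    obtain ⟨hil, rfl⟩ := mem_groupUsers.1 hi
    have := hgz (Sum.inl (i, l))
    simp only [g, hil, Sum.elim_inl, if_true] at this
    linarith
  obtain ⟨lam, hlam, hopt⟩ := exists_multipliers hF hg (x₀ := z₀) (fun i => le_rfl) hslater hb
  let zs : (N → ℝ) × (K → L → ℝ) := (x, groupMax net x)
  have hgs : ∀ s, g s zs ≤ 0 := by
    rintro (⟨i, l⟩ | l)
    · by_cases h : l ∈ net.route i
      · simp only [g, h, zs, Sum.elim_inl, if_true, sub_nonpos]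
        exact le_groupMax x (mem_groupUsers.2 ⟨h, rfl⟩)
      · simp [g, h]
    · exact sub_nonpos.2 (hx.1.2 l)
  have hcs : ∀ s, lam s * g s zs = 0 := by
    have h1 : ∀ s ∈ Finset.univ, lam s * g s zs ≤ 0 := fun s _ =>
      mul_nonpos_of_nonneg_of_nonpos (hlam s) (hgs s)
    have h2 := hopt zs hx.1.1
    have h3 : ∑ s, lam s * g s zs = 0 := le_antisymm (Finset.sum_nonpos h1) (by
      have : F zs = ∑ i, v i (x i) := rfl
      linarith)
    exact fun s => (Finset.sum_eq_zero_iff_of_nonpos h1).1 h3 s (Finset.mem_univ s)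
  let p : N → L → ℝ := fun i l => lam (Sum.inl (i, l))
  let w : L → ℝ := fun l => lam (Sum.inr l)
  have hsum : ∀ z, ∑ s, lam s * g s z =
      ∑ i, ∑ l, p i l * (if l ∈ net.route i then z.1 i - z.2 (net.group i) l else -1) +
        ∑ l, w l * (∑ k ∈ linkGroups net l, z.2 k l - net.cap l) := by
    intro z
    rw [Fintype.sum_sum_type, Fintype.sum_prod_type]
    rfl
  have hshift : ∀ z ∈ C, F z - ∑ s, lam s * g s z ≤ F zs - ∑ s, lam s * g s zs := by
    intro z hz
    rw [Finset.sum_eq_zero fun s _ => hcs s, sub_zero]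
    exact hopt z hz
  refine ⟨p, w, hx.1, fun i l _ => hlam _, fun l k hk => ?_, fun l => ?_, fun i l hl => ?_,
    fun i t ht => ?_⟩
  · have h : ∀ t : ℝ, t * (∑ i ∈ groupUsers net k l, p i l - w l) ≤ 0 := by
      intro t
      have h1 := hshift (x, fun k' l' => groupMax net x k' l' +
        if k' = k then if l' = l then t else 0 else 0) hx.1.1
      have hF' : F (x, fun k' l' => groupMax net x k' l' +
        if k' = k then if l' = l then t else 0 else 0) = F zs := rfl
      rw [hF', sub_le_sub_iff_left, hsum, hsum] at h1
      have e1 : ∀ i l', p i l' * (if l' ∈ net.route i then x i - (groupMax net x (net.group i) l' +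
          if net.group i = k then if l' = l then t else 0 else 0) else -1) =
          p i l' * (if l' ∈ net.route i then x i - groupMax net x (net.group i) l' else -1) -
          (if l' = l then (if l ∈ net.route i ∧ net.group i = k then t * p i l else 0) else 0) := by
        intro i l'
        by_cases h1 : l' = l
        · subst h1
          by_cases h2 : l' ∈ net.route i <;> by_cases h3 : net.group i = k <;> simp [h2, h3]
          ring
        · simp [h1]
      have e2 : ∑ l', w l' * (∑ k' ∈ linkGroups net l', (groupMax net x k' l' +
          if k' = k then if l' = l then t else 0 else 0) - net.cap l') =
          ∑ l', w l' * (∑ k' ∈ linkGroups net l', groupMax net x k' l' - net.cap l') +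
          t * w l := by
        have : t * w l = ∑ l', if l' = l then t * w l else 0 := by simp
        rw [this, ← Finset.sum_add_distrib]
        refine Finset.sum_congr rfl fun l' _ => ?_
        rw [Finset.sum_add_distrib]
        by_cases h1 : l' = l
        · subst h1
          simp [hk]
          ring
        · simp [h1]
      simp only [e1, e2, zs, Finset.sum_sub_distrib] at h1
      have e3 : ∑ i, ∑ l', (if l' = l then
          (if l ∈ net.route i ∧ net.group i = k then t * p i l else 0) else 0) =
          t * ∑ i ∈ groupUsers net k l, p i l := by
        simp only [Finset.sum_ite_eq', Finset.mem_univ, if_true]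
        rw [← Finset.sum_filter, Finset.mul_sum]
        refine Finset.sum_congr ?_ fun _ _ => rfl
        ext i
        simp [mem_groupUsers]
      rw [e3] at h1
      linarith
    linarith [h 1, h (-1)]
  · have := hcs (Sum.inr l)
    simp only [g, zs, Sum.elim_inr] at this
    simp only [w]
    linarith
  · have := hcs (Sum.inl (i, l))
    simp only [g, zs, Sum.elim_inl, hl, if_true] at this
    simp only [p]
    linarith
  · have h1 := hshift (Function.update x i t, groupMax net x) (fun j => by
      by_cases h : j = i
      · subst h; simpa using ht
      · simpa [h] using hx.1.1 j)
    rw [hsum, hsum] at h1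
    have e1 : ∀ (f : N → ℝ → ℝ), ∑ j, f j (Function.update x i t j) - ∑ j, f j (x j) =
        f i t - f i (x i) := by
      intro f
      rw [← Finset.sum_sub_distrib, Finset.sum_eq_single i]
      · simp
      · intro j _ hj; simp [hj]
      · simp
    have h2 := e1 v
    have h3 := e1 fun j s => ∑ l, p j l *
      (if l ∈ net.route j then s - groupMax net x (net.group j) l else -1)
    have h4 : ∀ s, ∑ l, p i l * (if l ∈ net.route i then s - groupMax net x (net.group i) l else -1)
        = (∑ l ∈ net.route i, p i l) * s + ∑ l, p i l *
          (if l ∈ net.route i then - groupMax net x (net.group i) l else -1) := by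
      intro s
      have : ∑ l ∈ net.route i, p i l = ∑ l, if l ∈ net.route i then p i l else 0 := by simp
      rw [this, Finset.sum_mul, ← Finset.sum_add_distrib]
      refine Finset.sum_congr rfl fun l _ => ?_
      split_ifs <;> ring
    simp only [h4] at h3
    simp only [F, zs] at h1
    linarith

end Problem

/-! ### Aggregation of sums along a tree -/

section Tree

open Finset

variable {V : Type*} {T : SimpleGraph V}

/-- The neighbour of `j` closer to `h` in a tree is unique. -/
theorem eq_of_dist_eq_add_one (hT : T.IsTree) {h j u u' : V} (hu : T.Adj j u) (hu' : T.Adj j u')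
    (hd : T.dist j h = T.dist u h + 1) (hd' : T.dist j h = T.dist u' h + 1) : u = u' := by
  obtain ⟨p, hp⟩ := hT.connected.exists_walk_length_eq_dist u h
  obtain ⟨p', hp'⟩ := hT.connected.exists_walk_length_eq_dist u' h
  -- Both neighbours begin a shortest walk from `j` to `h`, and paths in a tree are unique.
  have h1 : (SimpleGraph.Walk.cons hu p).IsPath :=
    SimpleGraph.Walk.isPath_of_length_eq_dist _ (by simp [hp, hd])
  have h2 : (SimpleGraph.Walk.cons hu' p').IsPath :=
    SimpleGraph.Walk.isPath_of_length_eq_dist _ (by simp [hp', hd'])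
  have h3 := (hT.existsUnique_path j h).unique h1 h2
  simpa using congrArg SimpleGraph.Walk.snd h3

theorem exists_adj_dist_eq_add_one (hT : T.IsTree) {h j : V} (hne : h ≠ j) :
    ∃ u, T.Adj j u ∧ T.dist j h = T.dist u h + 1 := by
  obtain ⟨p, hp⟩ := hT.connected.exists_walk_length_eq_dist j h
  cases p with
  | nil => exact absurd rfl hne
  | @cons _ u _ hadj q =>
    refine ⟨u, hadj, ?_⟩
    have h1 := SimpleGraph.dist_le q
    have h2 := hT.connected.dist_triangle (u := j) (v := u) (w := h)
    have h3 := SimpleGraph.dist_eq_one_iff_adj.2 hadj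
    simp only [SimpleGraph.Walk.length_cons] at hp
    omega

variable [Fintype V] [DecidableEq V] [DecidableRel T.Adj]

/-- Summaries that are consistent along the edges of a tree add up to the total at every vertex. -/
theorem sum_summaries_eq (hT : T.IsTree) {a : V → ℝ} {n : V → V → ℝ}
    (hn : ∀ i j, T.Adj i j → n i j = a j + ∑ h ∈ (T.neighborFinset j).erase i, n j h) (i : V) :
    a i + ∑ j ∈ T.neighborFinset i, n i j = ∑ j, a j := by
  set tot : V → ℝ := fun i => a i + ∑ j ∈ T.neighborFinset i, n i j
  have hpair : ∀ i j, T.Adj i j → n i j + n j i = tot j := by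
    intro i j hij
    have := sum_erase_add (T.neighborFinset j) (n j) (a := i) (by simpa using hij.symm)
    simp only [tot, hn i j hij]
    linarith
  have hadj : ∀ i j, T.Adj i j → tot i = tot j := fun i j hij => by
    rw [← hpair i j hij, ← hpair j i hij.symm, add_comm]
  have hconst : ∀ j, tot j = tot i := by
    intro j
    obtain ⟨p⟩ := hT.connected j i
    induction p with
    | nil => rfl
    | cons h _ ih => exact (hadj _ _ h).trans ih
  have hswap : ∑ j, ∑ h ∈ T.neighborFinset j, n j h = ∑ j, ∑ h ∈ T.neighborFinset j, n h j :=
    sum_comm' fun j h => by simp [T.adj_comm]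
  -- Double counting: a tree has `|V| - 1` edges, and on each edge the two opposite summaries add up
  -- to the common total. Comparison with `∑ j, tot j = |V| * tot i` identifies this total.
  have hsum : ∑ j, ∑ h ∈ T.neighborFinset j, (n j h + n h j) =
      (2 * (Fintype.card V - 1 : ℝ)) * tot i := by
    have h1 : ∀ j, ∑ h ∈ T.neighborFinset j, (n j h + n h j) = T.degree j * tot i := by
      intro j
      rw [← SimpleGraph.card_neighborFinset_eq_degree, ← nsmul_eq_mul, ← sum_const]
      refine sum_congr rfl fun h hh => ?_
      rw [hpair j h (by simpa using hh), hconst]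
    simp only [h1]
    rw [← sum_mul, ← Nat.cast_sum, T.sum_degrees_eq_twice_card_edges, ← hT.card_edgeFinset]
    push_cast
    ring
  have htot : ∑ j, tot j = Fintype.card V * tot i := by simp [hconst]
  simp only [sum_add_distrib] at hsum
  have htot' : ∑ j, tot j = ∑ j, a j + ∑ j, ∑ h ∈ T.neighborFinset j, n j h :=
    sum_add_distrib
  linarith

/-- The total of `a` over the component of `j` after removal of the edge from `i` to `j`. -/
noncomputable def branchSum (T : SimpleGraph V) (a : V → ℝ) (i j : V) : ℝ :=
  ∑ h with T.dist i h = T.dist j h + 1, a h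

/-- Behind the edge from `i` to `j` lie `j` itself and, disjointly, the branches behind the other
neighbours of `j`. This makes `branchSum` an explicit solution of the recursion for the summaries
`n`. -/
theorem branchSum_eq (hT : T.IsTree) (a : V → ℝ) {i j : V} (hij : T.Adj i j) :
    branchSum T a i j = a j + ∑ h ∈ (T.neighborFinset j).erase i, branchSum T a j h := by
  have hstep : ∀ {h : V}, h ≠ j → (T.dist i h = T.dist j h + 1 ↔
      ∃ u ∈ (T.neighborFinset j).erase i, T.dist j h = T.dist u h + 1) := by
    intro h hne
    obtain ⟨u, hu, hd⟩ := exists_adj_dist_eq_add_one hT hne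
    have hcase := hT.dist_eq_dist_add_one_of_adj h hij
    simp only [SimpleGraph.dist_comm (u := h)] at hcase
    constructor
    · intro h1
      refine ⟨u, ?_, hd⟩
      simp only [mem_erase, SimpleGraph.mem_neighborFinset, hu, and_true]
      rintro rfl
      omega
    · rintro ⟨u', hu', hd'⟩
      simp only [mem_erase, SimpleGraph.mem_neighborFinset] at hu'
      refine hcase.resolve_right fun h1 => hu'.1 ?_
      exact eq_of_dist_eq_add_one hT hu'.2 hij.symm hd' h1
  have hset : (univ.filter fun h => T.dist i h = T.dist j h + 1) =
      insert j (((T.neighborFinset j).erase i).biUnion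
        fun u => univ.filter fun h => T.dist j h = T.dist u h + 1) := by
    ext h
    by_cases hne : h = j
    · subst hne
      simp [SimpleGraph.dist_eq_one_iff_adj.2 hij]
    · simp only [mem_filter, mem_univ, true_and, mem_insert, hne, false_or, mem_biUnion]
      exact hstep hne
  unfold branchSum
  rw [hset, sum_insert, sum_biUnion]
  · intro u hu u' hu' hne
    rw [Function.onFun, disjoint_left]
    intro h hh hh'
    simp only [coe_erase, Set.mem_sdiff, mem_coe, SimpleGraph.mem_neighborFinset] at hu hu'
    simp only [mem_filter, mem_univ, true_and] at hh hh'
    exact hne (eq_of_dist_eq_add_one hT hu.1 hu'.1 hh hh')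
  · simp

end Tree

/-! ### Separation of the tax into own message and neighbours' data -/

section Mechanism

variable {N L K : Type*} [Fintype N] [Fintype L] [Fintype K] {net : Network N L K}
  {G : MessageGraph net}

theorem mem_nbrs {i j : N} : j ∈ nbrs G i ↔ G.graph.Adj i j := by
  simp [nbrs]

theorem mem_linkNbrs {i j : N} {l : L} :
    j ∈ linkNbrs G i l ↔ G.graph.Adj i j ∧ l ∈ net.route j := by
  simp [linkNbrs, mem_nbrs]

theorem mem_clients {i j : N} : j ∈ clients G i ↔ G.Φ j = i := by
  simp only [clients, Finset.mem_filter, mem_nbrs, and_iff_right_iff_imp]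
  rintro rfl
  exact (G.adj_Φ j).symm

theorem mem_centerLinks {i : N} {l : L} :
    l ∈ centerLinks G i ↔ l ∈ net.route i ∧ G.center (net.group i) l = i := by
  simp [centerLinks]

theorem mem_peers {i j : N} {l : L} :
    j ∈ peers net i l ↔ j ≠ i ∧ l ∈ net.route j ∧ net.group j = net.group i := by
  simp [peers, mem_groupUsers]

theorem adj_center {i : N} {l : L} (hl : l ∈ net.route i) (hc : l ∉ centerLinks G i) :
    G.graph.Adj i (G.center (net.group i) l) :=
  (G.center_adj l _ (group_mem_linkGroups hl) i (mem_groupUsers.2 ⟨hl, rfl⟩)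
    fun h => hc (mem_centerLinks.2 ⟨hl, h.symm⟩)).symm

theorem adj_peer {i j : N} {l : L} (hc : l ∈ centerLinks G i) (hj : j ∈ peers net i l) :
    G.graph.Adj i j := by
  obtain ⟨hl, hi⟩ := mem_centerLinks.1 hc
  obtain ⟨hne, hjl, hk⟩ := mem_peers.1 hj
  have := G.center_adj l _ (group_mem_linkGroups hl) j (mem_groupUsers.2 ⟨hjl, hk⟩)
  rw [hi] at this
  exact this hne

theorem center_spec {k : K} {l : L} (hk : k ∈ linkGroups net l) :
    l ∈ net.route (G.center k l) ∧ net.group (G.center k l) = k ∧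
      l ∈ centerLinks G (G.center k l) := by
  have h := mem_groupUsers.1 (G.center_mem l k hk)
  exact ⟨h.1, h.2, mem_centerLinks.2 ⟨h.1, by rw [h.2]⟩⟩

variable (G) in
open Classical in
/-- The price of the group of agent `i` on link `l`, as seen by `i` (for `l ∈ route i`). -/
noncomputable def groupPrice (m : N → Message N L) (i : N) (l : L) : ℝ :=
  if l ∈ centerLinks G i then proxyPrice G m i l + ∑ j ∈ peers net i l, (m j).p1 l
  else (m (G.center (net.group i) l)).w l

variable (G) in
open Classical in
/-- The squared deviations of the message `μ` of agent `i` from the values that the messages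
of its neighbours suggest. -/
noncomputable def mismatch (m : N → Message N L) (i : N) (μ : Message N L) : ℝ :=
  ∑ j ∈ clients G i, ∑ l ∈ net.route j,
      ((μ.p2 j l - (m j).p1 l) ^ 2 + (μ.a2 j l - (m j).a1 l) ^ 2) +
    ∑ j ∈ clients G i, (μ.q j - (m j).y) ^ 2 +
    ∑ l, ∑ j ∈ nbrs G i, (μ.n j l - report G m i j l) ^ 2 +
    ∑ l ∈ net.route i, ((μ.ylow l - share G m i l) ^ 2 + (μ.w l - groupPrice G m i l) ^ 2) +
    ∑ l ∈ centerLinks G i, ((μ.z1 l - zbar1 G m i l) ^ 2 + (μ.z2 l - zbar2 G m i l) ^ 2)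

variable (G) in
/-- The tax terms for link `l` that agent `i` controls through `¹p` and `¹a`. -/
noncomputable def adjustment (m : N → Message N L) (r₀ : N → ℝ) (i : N) (l : L) (p a : ℝ) : ℝ :=
  wbar G m i l * (groupPrice G m i l - proxyPrice G m i l + p + a - (m (G.Φ i)).a2 i l
      - wbar G m i l) * (net.cap l - radial G m r₀ i * load G m i l) ^ 2 +
    (groupPrice G m i l - proxyPrice G m i l + p + a - (m (G.Φ i)).a2 i l - wbar G m i l) ^ 2 +
    proxyPrice G m i l * (p - proxyPrice G m i l) * (zbar1 G m i l - proxyDemand G m i) ^ 2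

/-- At a center, `groupPrice` contains the proxy price where `what` contains the own `¹p`;
exchanging the two gives one formula for both roles. -/
theorem what_eq (m : N → Message N L) {i : N} {l : L} (hl : l ∈ net.route i) :
    what G m i l =
      groupPrice G m i l - proxyPrice G m i l + (m i).p1 l + (m i).a1 l - (m (G.Φ i)).a2 i l := by
  classical
  rw [what, groupPrice]
  split_ifs
  · rw [peers, ← Finset.sum_erase_add (groupUsers net (net.group i) l) _
      (mem_groupUsers.2 ⟨hl, rfl⟩)]
    ring
  · ring

theorem tax_eq (m : N → Message N L) (r₀ : N → ℝ) (i : N) :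
    tax G m r₀ i = mismatch G m i (m i) + ∑ l ∈ net.route i,
      (proxyPrice G m i l * alloc G m r₀ i +
        adjustment G m r₀ i l ((m i).p1 l) ((m i).a1 l)) := by
  classical
  have h1 : ∑ l ∈ centerLinks G i,
      (((m i).z1 l - zbar1 G m i l) ^ 2 + ((m i).z2 l - zbar2 G m i l) ^ 2) =
      ∑ l ∈ net.route i, if l ∈ centerLinks G i then
        ((m i).z1 l - zbar1 G m i l) ^ 2 + ((m i).z2 l - zbar2 G m i l) ^ 2 else 0 := by
    rw [← Finset.sum_filter]
    refine Finset.sum_congr ?_ fun _ _ => rfl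
    ext l
    simp only [mem_centerLinks, Finset.mem_filter]
    tauto
  have h2 : ∑ l, taxLink G m r₀ i l = ∑ l, taxSummary G m i l +
      ∑ l ∈ net.route i, (taxUser G m r₀ i l + taxRole G m i l) := by
    simp only [taxLink, Finset.sum_add_distrib, Finset.sum_ite_mem, Finset.univ_inter]
  have h3 : ∀ l ∈ net.route i, taxUser G m r₀ i l + taxRole G m i l =
      ((((m i).ylow l - share G m i l) ^ 2 + ((m i).w l - groupPrice G m i l) ^ 2) +
        if l ∈ centerLinks G i then
          ((m i).z1 l - zbar1 G m i l) ^ 2 + ((m i).z2 l - zbar2 G m i l) ^ 2 else 0) +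
      (proxyPrice G m i l * alloc G m r₀ i +
        adjustment G m r₀ i l ((m i).p1 l) ((m i).a1 l)) := by
    intro l hl
    rw [taxUser, taxRole, what_eq m hl, adjustment, groupPrice]
    split_ifs <;> ring
  rw [tax, h2, Finset.sum_congr rfl h3, mismatch, h1, Finset.sum_add_distrib,
    Finset.sum_add_distrib, taxConsensus]
  simp only [taxSummary]
  ring

/-! ### Locality: aggregates seen by an agent depend on its neighbours only -/

section Congr

variable {m m' : N → Message N L} {i : N} (h : ∀ j, G.graph.Adj i j → m j = m' j)
include h

theorem proxyDemand_congr : proxyDemand G m i = proxyDemand G m' i := by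
  rw [proxyDemand, proxyDemand, h _ (G.adj_Φ i)]

theorem proxyPrice_congr (l : L) : proxyPrice G m i l = proxyPrice G m' i l := by
  rw [proxyPrice, proxyPrice, h _ (G.adj_Φ i)]

theorem zbar1_congr {l : L} (hl : l ∈ net.route i) : zbar1 G m i l = zbar1 G m' i l := by
  rw [zbar1, zbar1]
  split_ifs with hc
  · rw [proxyDemand_congr h]
    exact Finset.fold_congr fun j hj => by rw [h j (adj_peer hc hj)]
  · rw [h _ (adj_center hl hc)]

theorem zbar2_congr {l : L} (hl : l ∈ net.route i) : zbar2 G m i l = zbar2 G m' i l := by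
  rw [zbar2, zbar2]
  by_cases hc : l ∈ centerLinks G i
  · rw [if_pos hc, if_pos hc, proxyDemand_congr h, zbar1_congr h hl]
    congr 1
    exact Finset.sum_congr rfl fun j hj => by rw [h j (adj_peer hc hj)]
  · rw [if_neg hc, if_neg hc, h _ (adj_center hl hc)]

theorem share_congr {l : L} (hl : l ∈ net.route i) : share G m i l = share G m' i l := by
  rw [share, share, proxyDemand_congr h, zbar1_congr h hl, zbar2_congr h hl]

theorem report_congr {j : N} (hj : j ∈ nbrs G i) (l : L) :
    report G m i j l = report G m' i j l := by
  rw [report, report, h j (mem_nbrs.1 hj)]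

theorem load_congr (l : L) : load G m i l = load G m' i l := by
  rw [load, load]
  congr 1
  · split_ifs with hl
    · exact share_congr h hl
    · rfl
  · exact Finset.sum_congr rfl fun j hj => report_congr h hj l

theorem radial_congr (r₀ : N → ℝ) : radial G m r₀ i = radial G m' r₀ i := by
  have : load G m i = load G m' i := funext (load_congr h)
  simp only [radial, this]

theorem wbar_congr (l : L) : wbar G m i l = wbar G m' i l := by
  rw [wbar, wbar]
  congr 1
  exact Finset.sum_congr rfl fun j hj => by rw [h j (mem_linkNbrs.1 hj).1]

theorem groupPrice_congr {l : L} (hl : l ∈ net.route i) :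
    groupPrice G m i l = groupPrice G m' i l := by
  rw [groupPrice, groupPrice]
  split_ifs with hc
  · rw [proxyPrice_congr h]
    congr 1
    exact Finset.sum_congr rfl fun j hj => by rw [h j (adj_peer hc hj)]
  · rw [h _ (adj_center hl hc)]

theorem mismatch_congr (μ : Message N L) : mismatch G m i μ = mismatch G m' i μ := by
  have hcl : ∀ j ∈ clients G i, m j = m' j := fun j hj => h j <| by
    obtain rfl := mem_clients.1 hj
    exact (G.adj_Φ j).symm
  rw [mismatch, mismatch]
  congr 1
  · congr 1
    · congr 1
      · congr 1
        · exact Finset.sum_congr rfl fun j hj => by rw [hcl j hj]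
        · exact Finset.sum_congr rfl fun j hj => by rw [hcl j hj]
      · exact Finset.sum_congr rfl fun l _ => Finset.sum_congr rfl fun j hj => by
          rw [report_congr h hj]
    · exact Finset.sum_congr rfl fun l hl => by rw [share_congr h hl, groupPrice_congr h hl]
  · refine Finset.sum_congr rfl fun l hl => ?_
    have hl' := (mem_centerLinks.1 hl).1
    rw [zbar1_congr h hl', zbar2_congr h hl']

theorem adjustment_congr (r₀ : N → ℝ) {l : L} (hl : l ∈ net.route i) (p a : ℝ) :
    adjustment G m r₀ i l p a = adjustment G m' r₀ i l p a := by
  rw [adjustment, adjustment, wbar_congr h, groupPrice_congr h hl, proxyPrice_congr h,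
    h _ (G.adj_Φ i), radial_congr h, load_congr h, zbar1_congr h hl, proxyDemand_congr h]

theorem alloc_congr (r₀ : N → ℝ) (hi : m i = m' i) : alloc G m r₀ i = alloc G m' r₀ i := by
  rw [alloc, alloc, radial_congr h, hi]

theorem tax_congr (r₀ : N → ℝ) (hi : m i = m' i) : tax G m r₀ i = tax G m' r₀ i := by
  rw [tax_eq, tax_eq, mismatch_congr h, alloc_congr h r₀ hi, hi]
  congr 1
  exact Finset.sum_congr rfl fun l hl => by rw [proxyPrice_congr h, adjustment_congr h r₀ hl]

end Congr

variable (G) in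
/-- The utility of agent `i` when it sends `μ` and the others send their messages in `m`. -/
noncomputable def payoff (m : N → Message N L) (v : N → ℝ → ℝ) (r₀ : N → ℝ) (i : N)
    (μ : Message N L) : ℝ :=
  v i (radial G m r₀ i * μ.y) - (mismatch G m i μ + ∑ l ∈ net.route i,
    (proxyPrice G m i l * (radial G m r₀ i * μ.y) + adjustment G m r₀ i l (μ.p1 l) (μ.a1 l)))

theorem utility_eq (m : N → Message N L) (v : N → ℝ → ℝ) (r₀ : N → ℝ) (i : N) :
    utility G m v r₀ i = payoff G m v r₀ i (m i) := by
  rw [utility, tax_eq]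
  rfl

open Classical in
-- An agent is not its own neighbour, so its deviation leaves all the aggregates it sees unchanged.
theorem utility_update (m : N → Message N L) (v : N → ℝ → ℝ) (r₀ : N → ℝ) (i : N)
    (μ : Message N L) : utility G (Function.update m i μ) v r₀ i = payoff G m v r₀ i μ := by
  have h : ∀ j, G.graph.Adj i j → Function.update m i μ j = m j := fun j hj =>
    Function.update_of_ne hj.ne' _ _
  rw [utility_eq, Function.update_self, payoff, payoff, radial_congr h, mismatch_congr h]
  congr 2
  exact Finset.sum_congr rfl fun l hl => by rw [proxyPrice_congr h, adjustment_congr h r₀ hl]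

theorem isNash_iff {m : N → Message N L} {v : N → ℝ → ℝ} {r₀ : N → ℝ} :
    IsNash G m v r₀ ↔ IsProfile G m ∧ ∀ i, ∀ μ ∈ messageSpace G i,
      payoff G m v r₀ i μ ≤ payoff G m v r₀ i (m i) := by
  simp only [IsNash, utility_update]
  simp only [utility_eq]

theorem mismatch_nonneg (m : N → Message N L) (i : N) (μ : Message N L) :
    0 ≤ mismatch G m i μ := by
  rw [mismatch]
  positivity

theorem mismatch_eq_zero_iff {m : N → Message N L} {i : N} {μ : Message N L} :
    mismatch G m i μ = 0 ↔
      (∀ j ∈ clients G i, ∀ l ∈ net.route j,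
        μ.p2 j l = (m j).p1 l ∧ μ.a2 j l = (m j).a1 l) ∧
      (∀ j ∈ clients G i, μ.q j = (m j).y) ∧
      (∀ l, ∀ j ∈ nbrs G i, μ.n j l = report G m i j l) ∧
      (∀ l ∈ net.route i, μ.ylow l = share G m i l ∧ μ.w l = groupPrice G m i l) ∧
      (∀ l ∈ centerLinks G i, μ.z1 l = zbar1 G m i l ∧ μ.z2 l = zbar2 G m i l) := by
  have two : ∀ a b c d : ℝ, (a - b) ^ 2 + (c - d) ^ 2 = 0 ↔ a = b ∧ c = d := by
    intro a b c d
    rw [add_eq_zero_iff_of_nonneg (sq_nonneg _) (sq_nonneg _)]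
    simp [sub_eq_zero]
  have one : ∀ a b : ℝ, (a - b) ^ 2 = 0 ↔ a = b := by
    intro a b
    simp [sub_eq_zero]
  rw [mismatch, add_eq_zero_iff_of_nonneg (by positivity) (by positivity),
    add_eq_zero_iff_of_nonneg (by positivity) (by positivity),
    add_eq_zero_iff_of_nonneg (by positivity) (by positivity),
    add_eq_zero_iff_of_nonneg (by positivity) (by positivity),
    Finset.sum_eq_zero_iff_of_nonneg fun _ _ => by positivity,
    Finset.sum_eq_zero_iff_of_nonneg fun _ _ => by positivity,
    Finset.sum_eq_zero_iff_of_nonneg fun _ _ => by positivity,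
    Finset.sum_eq_zero_iff_of_nonneg fun _ _ => by positivity,
    Finset.sum_eq_zero_iff_of_nonneg fun _ _ => by positivity]
  simp only [Finset.sum_eq_zero_iff_of_nonneg fun _ _ => add_nonneg (sq_nonneg _) (sq_nonneg _),
    Finset.sum_eq_zero_iff_of_nonneg fun _ _ => sq_nonneg _, two, one, Finset.mem_univ,
    true_implies, and_assoc]

/-! ### Consistent profiles and what their aggregates compute -/

section Profile

variable {m : N → Message N L}

theorem IsProfile.y_nonneg (hm : IsProfile G m) (i : N) : 0 ≤ (m i).y := (hm i).1

theorem IsProfile.ylow_spec (hm : IsProfile G m) (i : N) (l : L) :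
    0 ≤ (m i).ylow l ∧ (l ∉ net.route i → (m i).ylow l = 0) := (hm i).2.1 l

theorem IsProfile.n_nonneg (hm : IsProfile G m) (i j : N) (l : L) : 0 ≤ (m i).n j l :=
  ((hm i).2.2.1 (j, l)).1

theorem IsProfile.q_nonneg (hm : IsProfile G m) (i j : N) : 0 ≤ (m i).q j :=
  ((hm i).2.2.2.1 j).1

theorem IsProfile.p1_spec (hm : IsProfile G m) (i : N) :
    NonnegOn (fun l => l ∈ net.route i) (m i).p1 := (hm i).2.2.2.2.1

theorem IsProfile.p2_nonneg (hm : IsProfile G m) (i j : N) (l : L) : 0 ≤ (m i).p2 j l :=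
  ((hm i).2.2.2.2.2.1 (j, l)).1

theorem IsProfile.w_nonneg (hm : IsProfile G m) (i : N) (l : L) : 0 ≤ (m i).w l :=
  ((hm i).2.2.2.2.2.2.1 l).1

theorem IsProfile.z1_nonneg (hm : IsProfile G m) (i : N) (l : L) : 0 ≤ (m i).z1 l :=
  ((hm i).2.2.2.2.2.2.2.1 l).1

theorem IsProfile.z2_nonneg (hm : IsProfile G m) (i : N) (l : L) : 0 ≤ (m i).z2 l :=
  ((hm i).2.2.2.2.2.2.2.2.1 l).1

theorem IsProfile.a1_spec (hm : IsProfile G m) (i : N) :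
    PosOn (fun l => l ∈ net.route i) (m i).a1 := (hm i).2.2.2.2.2.2.2.2.2.1

theorem IsProfile.zbar1_nonneg (hm : IsProfile G m) (i : N) (l : L) : 0 ≤ zbar1 G m i l := by
  rw [zbar1]
  split_ifs
  · exact (Finset.le_fold_max _).2 (Or.inl (hm.q_nonneg _ _))
  · exact hm.z1_nonneg _ _

theorem IsProfile.zbar2_nonneg (hm : IsProfile G m) (i : N) (l : L) : 0 ≤ zbar2 G m i l := by
  rw [zbar2]
  split_ifs
  · exact add_nonneg zero_le_one (Finset.sum_nonneg fun _ _ => by split_ifs <;> norm_num)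
  · exact add_nonneg le_rfl (Finset.sum_nonneg fun _ _ => by split_ifs <;> norm_num)
  · exact hm.z2_nonneg _ _

theorem IsProfile.share_nonneg (hm : IsProfile G m) (i : N) (l : L) : 0 ≤ share G m i l := by
  rw [share]
  refine div_nonneg (mul_nonneg (hm.q_nonneg _ _) ?_) (hm.zbar2_nonneg i l)
  split_ifs <;> norm_num

theorem IsProfile.report_nonneg (hm : IsProfile G m) (i j : N) (l : L) :
    0 ≤ report G m i j l :=
  add_nonneg (hm.ylow_spec j l).1 (Finset.sum_nonneg fun _ _ => hm.n_nonneg _ _ _)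

theorem IsProfile.groupPrice_nonneg (hm : IsProfile G m) (i : N) (l : L) :
    0 ≤ groupPrice G m i l := by
  rw [groupPrice]
  split_ifs
  · exact add_nonneg (hm.p2_nonneg _ _ _) (Finset.sum_nonneg fun j _ => (hm.p1_spec j l).1)
  · exact hm.w_nonneg _ _

theorem IsProfile.wbar_nonneg (hm : IsProfile G m) (i : N) (l : L) : 0 ≤ wbar G m i l :=
  mul_nonneg (by positivity) (Finset.sum_nonneg fun j _ => hm.w_nonneg _ _)

variable (G) in
open Classical in
/-- The message of agent `i` that agrees with the values suggested by its neighbours. -/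
noncomputable def truthful (m : N → Message N L) (i : N) (y : ℝ) (p a : L → ℝ) : Message N L where
  y := y
  ylow l := if l ∈ net.route i then share G m i l else 0
  n j l := if j ∈ nbrs G i then report G m i j l else 0
  q j := if j ∈ clients G i then (m j).y else 0
  p1 := p
  p2 j l := if j ∈ clients G i ∧ l ∈ net.route j then (m j).p1 l else 0
  w l := if l ∈ net.route i then groupPrice G m i l else 0
  z1 l := if l ∈ centerLinks G i then zbar1 G m i l else 0
  z2 l := if l ∈ centerLinks G i then zbar2 G m i l else 0
  a1 := a
  a2 j l := if j ∈ clients G i ∧ l ∈ net.route j then (m j).a1 l else 0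

theorem nonnegOn_ite {α : Type*} {S : α → Prop} [DecidablePred S] {g : α → ℝ} (hg : ∀ a, 0 ≤ g a) :
    NonnegOn S fun a => if S a then g a else 0 := by
  intro a
  by_cases h : S a <;> simp [h, hg]

open Classical in
theorem IsProfile.truthful_mem (hm : IsProfile G m) {i : N} {y : ℝ} (hy : 0 ≤ y) {p a : L → ℝ}
    (hp : NonnegOn (fun l => l ∈ net.route i) p) (ha : PosOn (fun l => l ∈ net.route i) a) :
    truthful G m i y p a ∈ messageSpace G i := by
  refine ⟨hy, nonnegOn_ite fun l => hm.share_nonneg i l,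
    nonnegOn_ite (g := fun jl : N × L => report G m i jl.1 jl.2)
      fun jl => hm.report_nonneg i jl.1 jl.2, nonnegOn_ite fun j => hm.y_nonneg j, hp,
    nonnegOn_ite (g := fun jl : N × L => (m jl.1).p1 jl.2)
      fun jl => (hm.p1_spec jl.1 jl.2).1, nonnegOn_ite fun l => hm.groupPrice_nonneg i l,
    nonnegOn_ite fun l => hm.zbar1_nonneg i l,
    nonnegOn_ite fun l => hm.zbar2_nonneg i l,
    ha, ?_⟩
  rintro ⟨j, l⟩
  refine ⟨fun h => ?_, fun h => if_neg h⟩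
  simp only [truthful, if_pos h]
  exact (hm.a1_spec j l).1 h.2

theorem mismatch_truthful (m : N → Message N L) (i : N) (y : ℝ) (p a : L → ℝ) :
    mismatch G m i (truthful G m i y p a) = 0 := by
  rw [mismatch_eq_zero_iff]
  refine ⟨fun j hj l hl => ?_, fun j hj => ?_, fun l j hj => ?_, fun l hl => ?_, fun l hl => ?_⟩ <;>
  simp [truthful, *]

section Consistent

variable (hc : ∀ i, mismatch G m i (m i) = 0)
include hc

theorem proxyDemand_eq (i : N) : proxyDemand G m i = (m i).y :=
  (mismatch_eq_zero_iff.1 (hc (G.Φ i))).2.1 i (mem_clients.2 rfl)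

theorem proxyPrice_eq {i : N} {l : L} (hl : l ∈ net.route i) :
    proxyPrice G m i l = (m i).p1 l :=
  ((mismatch_eq_zero_iff.1 (hc (G.Φ i))).1 i (mem_clients.2 rfl) l hl).1

theorem proxy_a_eq {i : N} {l : L} (hl : l ∈ net.route i) :
    (m (G.Φ i)).a2 i l = (m i).a1 l :=
  ((mismatch_eq_zero_iff.1 (hc (G.Φ i))).1 i (mem_clients.2 rfl) l hl).2

theorem groupPrice_eq {i : N} {l : L} (hl : l ∈ net.route i) :
    groupPrice G m i l = (m i).w l :=
  ((mismatch_eq_zero_iff.1 (hc i)).2.2.2.1 l hl).2.symm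

theorem sum_p1_eq {k : K} {l : L} (hk : k ∈ linkGroups net l) :
    ∑ i ∈ groupUsers net k l, (m i).p1 l = (m (G.center k l)).w l := by
  classical
  obtain ⟨h1, h2, h3⟩ := center_spec (G := G) hk
  rw [← groupPrice_eq hc h1, groupPrice, if_pos h3, proxyPrice_eq hc h1, peers, h2,
    Finset.add_sum_erase _ (fun i => (m i).p1 l) (G.center_mem l k hk)]

end Consistent

open Classical in
/-- The number of users of link `l` in group `k` with the maximal value of `x`. -/
noncomputable def maxCount (net : Network N L K) (x : N → ℝ) (k : K) (l : L) : ℝ :=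
  ∑ j ∈ groupUsers net k l, if groupMax net x k l = x j then 1 else 0

theorem maxCount_pos (x : N → ℝ) {k : K} {l : L} (hk : k ∈ linkGroups net l) :
    0 < maxCount net x k l := by
  obtain ⟨i, hi, hix⟩ := exists_eq_groupMax x hk
  refine Finset.sum_pos' (fun j _ => by split_ifs <;> norm_num) ⟨i, hi, by simp [hix]⟩

open Classical in
/-- The demand of group `k` on link `l`, divided equally among its users with maximal demand. -/
noncomputable def equalShare (net : Network N L K) (x : N → ℝ) (i : N) (l : L) : ℝ :=
  x i * (if groupMax net x (net.group i) l = x i then 1 else 0) / maxCount net x (net.group i) l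

theorem sum_equalShare (x : N → ℝ) {k : K} {l : L} (hk : k ∈ linkGroups net l) :
    ∑ i ∈ groupUsers net k l, equalShare net x i l = groupMax net x k l := by
  have h : ∀ i ∈ groupUsers net k l, equalShare net x i l =
      (groupMax net x k l / maxCount net x k l) * if groupMax net x k l = x i then 1 else 0 := by
    intro i hi
    obtain ⟨-, rfl⟩ := mem_groupUsers.1 hi
    rw [equalShare]
    split_ifs with h
    · rw [← h]; ring
    · ring
  rw [Finset.sum_congr rfl h, ← Finset.mul_sum]
  exact div_mul_cancel₀ _ (maxCount_pos x hk).ne'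

/-! ### Group demands from `hq` and `hz` alone, so usable before the mismatch is known to vanish -/

section Demand

variable (hq : ∀ i, proxyDemand G m i = (m i).y)
include hq

theorem zbar1_center {i : N} {l : L} (hl : l ∈ centerLinks G i) :
    zbar1 G m i l = groupMax net (fun j => (m j).y) (net.group i) l := by
  have hi : i ∈ groupUsers net (net.group i) l :=
    mem_groupUsers.2 ⟨(mem_centerLinks.1 hl).1, rfl⟩
  rw [zbar1, if_pos hl, hq]
  apply le_antisymm
  · refine Finset.fold_max_le _ |>.2 ⟨le_groupMax (fun j => (m j).y) hi, fun j hj => ?_⟩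
    exact le_groupMax (fun j => (m j).y) (mem_groupUsers.2 (mem_peers.1 hj).2)
  · obtain ⟨j, hj, hjx⟩ := exists_eq_groupMax (fun j => (m j).y)
      (group_mem_linkGroups (mem_centerLinks.1 hl).1)
    rw [hjx, Finset.le_fold_max]
    by_cases hji : j = i
    · exact Or.inl (by rw [hji])
    · exact Or.inr ⟨j, mem_peers.2 ⟨hji, mem_groupUsers.1 hj⟩, le_rfl⟩

theorem zbar2_center {i : N} {l : L} (hl : l ∈ centerLinks G i) :
    zbar2 G m i l = maxCount net (fun j => (m j).y) (net.group i) l := by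
  classical
  have hi : i ∈ groupUsers net (net.group i) l :=
    mem_groupUsers.2 ⟨(mem_centerLinks.1 hl).1, rfl⟩
  rw [zbar2, if_pos hl, zbar1_center hq hl, hq, maxCount, peers]
  exact Finset.add_sum_erase _ (fun j =>
    if groupMax net (fun j => (m j).y) (net.group i) l = (m j).y then (1 : ℝ) else 0) hi

variable (hz : ∀ i, ∀ l ∈ centerLinks G i,
  (m i).z1 l = groupMax net (fun j => (m j).y) (net.group i) l ∧
  (m i).z2 l = maxCount net (fun j => (m j).y) (net.group i) l)
include hz

theorem zbar1_eq {i : N} {l : L} (hl : l ∈ net.route i) :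
    zbar1 G m i l = groupMax net (fun j => (m j).y) (net.group i) l := by
  by_cases h : l ∈ centerLinks G i
  · exact zbar1_center hq h
  · obtain ⟨-, h2, h3⟩ := center_spec (G := G) (group_mem_linkGroups hl)
    rw [zbar1, if_neg h, (hz _ l h3).1, h2]

theorem zbar2_eq {i : N} {l : L} (hl : l ∈ net.route i) :
    zbar2 G m i l = maxCount net (fun j => (m j).y) (net.group i) l := by
  by_cases h : l ∈ centerLinks G i
  · exact zbar2_center hq h
  · obtain ⟨-, h2, h3⟩ := center_spec (G := G) (group_mem_linkGroups hl)
    rw [zbar2, if_neg h, (hz _ l h3).2, h2]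

theorem share_eq {i : N} {l : L} (hl : l ∈ net.route i) :
    share G m i l = equalShare net (fun j => (m j).y) i l := by
  rw [share, equalShare, zbar1_eq hq hz hl, zbar2_eq hq hz hl, hq]

end Demand

section Consistent

variable (hc : ∀ i, mismatch G m i (m i) = 0)
include hc

theorem z_eq (i : N) (l : L) (hl : l ∈ centerLinks G i) :
    (m i).z1 l = groupMax net (fun j => (m j).y) (net.group i) l ∧
    (m i).z2 l = maxCount net (fun j => (m j).y) (net.group i) l := by
  have h := (mismatch_eq_zero_iff.1 (hc i)).2.2.2.2 l hl
  rwa [zbar1_center (proxyDemand_eq hc) hl, zbar2_center (proxyDemand_eq hc) hl] at h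

/-- Zero mismatch makes the summaries satisfy the tree recursion, so the load is the sum of all
shares. Ties split a group's maximum equally, so the shares of a group add up to it. -/
theorem load_eq (hm : IsProfile G m) (i : N) (l : L) :
    load G m i l = ∑ k ∈ linkGroups net l, groupMax net (fun j => (m j).y) k l := by
  classical
  have hnbrs : ∀ i, nbrs G i = G.graph.neighborFinset i := by
    intro i
    ext j
    simp [mem_nbrs]
  have hlow : ∀ i, (m i).ylow l = if l ∈ net.route i then share G m i l else 0 := by
    intro i
    split_ifs with h
    · exact ((mismatch_eq_zero_iff.1 (hc i)).2.2.2.1 l h).1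
    · exact (hm.ylow_spec i l).2 h
  have hn : ∀ i, ∀ j ∈ nbrs G i, (m i).n j l = report G m i j l := fun i j hj =>
    (mismatch_eq_zero_iff.1 (hc i)).2.2.1 l j hj
  have h1 := sum_summaries_eq G.isTree (a := fun i => (m i).ylow l) (n := fun i j => (m i).n j l)
    (fun i j hij => by
      rw [← hnbrs]
      exact hn i j (mem_nbrs.2 hij)) i
  rw [load, ← hlow, ← Finset.sum_congr rfl (hn i), hnbrs, h1]
  simp only [hlow]
  rw [← Finset.sum_filter]
  have h2 : (Finset.univ.filter fun i => l ∈ net.route i) = users net l := by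
    ext i
    simp [mem_users]
  rw [h2, sum_users_eq]
  refine Finset.sum_congr rfl fun k hk => ?_
  rw [← sum_equalShare _ hk]
  exact Finset.sum_congr rfl fun i hi =>
    share_eq (proxyDemand_eq hc) (z_eq hc) (mem_groupUsers.1 hi).1

end Consistent

theorem radial_pos {r₀ : N → ℝ} (hr₀ : ∀ i, 0 < r₀ i) (m : N → Message N L) (i : N) :
    0 < radial G m r₀ i := by
  rw [radial]
  split_ifs with h
  · rw [Finset.lt_inf'_iff]
    exact fun l hl => div_pos (net.cap_pos l) (by simpa using hl)
  · exact hr₀ i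

theorem radial_mul_load_le (r₀ : N → ℝ) {i : N} {l : L} (h : 0 ≤ load G m i l) :
    radial G m r₀ i * load G m i l ≤ net.cap l := by
  rcases h.eq_or_lt with h | h
  · rw [← h, mul_zero]
    exact (net.cap_pos l).le
  · rw [radial, dif_pos ⟨l, by simpa using h⟩, ← le_div_iff₀ h]
    exact Finset.inf'_le (fun l => net.cap l / load G m i l) (by simpa using h)

/-- A second group supplies another user of the link, and the first step of a walk to it among the
users is the required neighbour. Thus `wbar` is a genuine average. -/
theorem linkNbrs_nonempty (G : MessageGraph net) {i : N} {l : L} (hl : l ∈ net.route i) :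
    (linkNbrs G i l).Nonempty := by
  have hother : ∃ j, l ∈ net.route j ∧ j ≠ i := by
    obtain ⟨a, b, ha, hb, hne⟩ := net.two_groups l
    by_cases h : a = i
    · refine ⟨b, hb, ?_⟩
      rintro rfl
      exact hne (by rw [h])
    · exact ⟨a, ha, h⟩
  obtain ⟨j, hj, hne⟩ := hother
  obtain ⟨p⟩ := (G.users_connected l).preconnected
    (⟨i, mem_users.2 hl⟩ : {i | i ∈ users net l}) ⟨j, mem_users.2 hj⟩
  cases p with
  | nil => exact absurd rfl hne
  | @cons _ u _ h _ => exact ⟨u.1, mem_linkNbrs.2 ⟨h, mem_users.1 u.2⟩⟩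

theorem wbar_eq_of_forall {i : N} {l : L} (hl : l ∈ net.route i) {c : ℝ}
    (h : ∀ j, l ∈ net.route j → (m j).w l = c) : wbar G m i l = c := by
  have hpos : (0 : ℝ) < (linkNbrs G i l).card := by
    exact_mod_cast (linkNbrs_nonempty G hl).card_pos
  rw [wbar, Finset.sum_congr rfl fun j hj => h j (mem_linkNbrs.1 hj).2, Finset.sum_const,
    nsmul_eq_mul]
  field_simp

/-- Group prices that nowhere exceed the average over the neighbours are constant on each link. -/
theorem w_eq_of_le_wbar {l : L} (h : ∀ i, l ∈ net.route i → (m i).w l ≤ wbar G m i l) {i j : N}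
    (hi : l ∈ net.route i) (hj : l ∈ net.route j) : (m i).w l = (m j).w l := by
  obtain ⟨a, ha, hmax⟩ := Finset.exists_max_image (users net l) (fun i => (m i).w l)
    ⟨i, mem_users.2 hi⟩
  -- Discrete maximum principle: where `w` is maximal, the neighbours' average is at least the
  -- maximum, so every neighbour using the link attains it too. Connectedness of the users spreads
  -- this.
  have hstep : ∀ b c, l ∈ net.route b → l ∈ net.route c → G.graph.Adj b c →
      (m b).w l = (m a).w l → (m c).w l = (m a).w l := by
    intro b c hb hc hbc heq
    have hle : ∀ j ∈ linkNbrs G b l, (m j).w l ≤ (m a).w l := fun j hj =>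
      hmax j (mem_users.2 (mem_linkNbrs.1 hj).2)
    have hpos : (0 : ℝ) < (linkNbrs G b l).card := by
      exact_mod_cast (linkNbrs_nonempty G hb).card_pos
    have h1 := h b hb
    rw [heq, wbar, one_div, ← div_eq_inv_mul, le_div_iff₀ hpos] at h1
    have h2 : ∑ j ∈ linkNbrs G b l, (m j).w l = ∑ j ∈ linkNbrs G b l, (m a).w l := by
      refine le_antisymm (Finset.sum_le_sum hle) ?_
      rw [Finset.sum_const, nsmul_eq_mul]
      linarith
    exact (Finset.sum_eq_sum_iff_of_le hle).1 h2 c (mem_linkNbrs.2 ⟨hbc, hc⟩)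
  have hall : ∀ j, l ∈ net.route j → (m j).w l = (m a).w l := by
    intro j hj
    obtain ⟨p⟩ := (G.users_connected l).preconnected
      (⟨j, mem_users.2 hj⟩ : {i | i ∈ users net l}) ⟨a, ha⟩
    have key : ∀ u v : {i | i ∈ users net l},
        (G.graph.induce {i | i ∈ users net l}).Walk u v →
        (m v).w l = (m a).w l → (m u).w l = (m a).w l := by
      intro u v p hv
      induction p with
      | nil => exact hv
      | @cons u u' _ hadj _ ih =>
        exact hstep u' u (mem_users.1 u'.2) (mem_users.1 u.2)
          (show G.graph.Adj u u' from hadj).symm (ih hv)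
    exact key _ _ p rfl
  rw [hall i hi, hall j hj]

end Profile

end Mechanism

section Equilibrium

variable {N L K : Type*} [Fintype N] [Fintype L] [Fintype K] {net : Network N L K}
  {G : MessageGraph net} {v : N → ℝ → ℝ} {r₀ : N → ℝ}

/-! ### From supporting prices to an equilibrium -/

section Existence

variable (G) in
open Classical in
/-- The message profile built from a rate vector `x` with supporting prices `p` and `w`. -/
noncomputable def supportedProfile (x : N → ℝ) (p : N → L → ℝ) (w : L → ℝ) (i : N) :
    Message N L where
  y := x i
  ylow l := if l ∈ net.route i then equalShare net x i l else 0
  n j l := if j ∈ nbrs G i then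
    branchSum G.graph (fun h => if l ∈ net.route h then equalShare net x h l else 0) i j else 0
  q j := if j ∈ clients G i then x j else 0
  p1 l := if l ∈ net.route i then p i l else 0
  p2 j l := if j ∈ clients G i ∧ l ∈ net.route j then p j l else 0
  w l := if l ∈ net.route i then w l else 0
  z1 l := if l ∈ centerLinks G i then groupMax net x (net.group i) l else 0
  z2 l := if l ∈ centerLinks G i then maxCount net x (net.group i) l else 0
  a1 l := if l ∈ net.route i then 1 else 0
  a2 j l := if j ∈ clients G i ∧ l ∈ net.route j then 1 else 0

variable {x : N → ℝ} {p : N → L → ℝ} {w : L → ℝ}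

theorem maxCount_nonneg (x : N → ℝ) (k : K) (l : L) : 0 ≤ maxCount net x k l :=
  Finset.sum_nonneg fun _ _ => by split_ifs <;> norm_num

theorem equalShare_nonneg (hx : ∀ i, 0 ≤ x i) (i : N) (l : L) : 0 ≤ equalShare net x i l := by
  refine div_nonneg (mul_nonneg (hx i) ?_) (maxCount_nonneg x _ l)
  split_ifs <;> norm_num

theorem nonnegOn_ite_of_mem {α : Type*} {S : α → Prop} [DecidablePred S] {g : α → ℝ}
    (hg : ∀ a, S a → 0 ≤ g a) :
    NonnegOn S fun a => if S a then g a else 0 := by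
  intro a
  by_cases h : S a <;> simp [h, hg]

theorem posOn_ite_one {α : Type*} {S : α → Prop} [DecidablePred S] :
    PosOn S fun a => if S a then (1 : ℝ) else 0 := by
  intro a
  by_cases h : S a <;> simp [h]

open Classical in
theorem Supports.isProfile (h : Supports net v x p w) :
    IsProfile G (supportedProfile G x p w) := by
  intro i
  have hx := h.feasible.1
  refine ⟨hx i, nonnegOn_ite fun l => equalShare_nonneg hx i l,
    nonnegOn_ite (g := fun jl : N × L => branchSum G.graph
      (fun h => if jl.2 ∈ net.route h then equalShare net x h jl.2 else 0) i jl.1)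
      fun jl => Finset.sum_nonneg fun h _ => ?_,
    nonnegOn_ite hx, nonnegOn_ite_of_mem fun l hl => h.nonneg i l hl,
    nonnegOn_ite_of_mem (g := fun jl : N × L => p jl.1 jl.2) fun jl hjl => h.nonneg _ _ hjl.2,
    nonnegOn_ite h.w_nonneg, nonnegOn_ite fun l => groupMax_nonneg hx _ l,
    nonnegOn_ite fun l => maxCount_nonneg x _ l, posOn_ite_one, posOn_ite_one⟩
  split_ifs
  · exact equalShare_nonneg hx h jl.2
  · exact le_rfl

theorem Supports.mismatch_eq_zero (h : Supports net v x p w) (i : N) :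
    mismatch G (supportedProfile G x p w) i (supportedProfile G x p w i) = 0 := by
  classical
  set m := supportedProfile G x p w with hmdef
  have hy : (fun j => (m j).y) = x := rfl
  have hq : ∀ i, proxyDemand G m i = (m i).y := by
    intro i
    simp [proxyDemand, hmdef, supportedProfile, mem_clients]
  have hz : ∀ i, ∀ l ∈ centerLinks G i,
      (m i).z1 l = groupMax net (fun j => (m j).y) (net.group i) l ∧
      (m i).z2 l = maxCount net (fun j => (m j).y) (net.group i) l := by
    intro i l hl
    rw [hy]
    simp [hmdef, supportedProfile, hl]
  have hnbrs : ∀ i, nbrs G i = G.graph.neighborFinset i := by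
    intro i
    ext j
    simp [mem_nbrs]
  rw [mismatch_eq_zero_iff]
  refine ⟨fun j hj l hl => ?_, fun j hj => ?_, fun l j hj => ?_, fun l hl => ⟨?_, ?_⟩,
    fun l hl => ⟨?_, ?_⟩⟩
  · simp [hmdef, supportedProfile, hj, hl]
  · simp [hmdef, supportedProfile, hj]
  · have h1 : (m i).n j l = branchSum G.graph
        (fun h => if l ∈ net.route h then equalShare net x h l else 0) i j := if_pos hj
    rw [h1, branchSum_eq G.isTree _ (mem_nbrs.1 hj), report, hnbrs]
    congr 1
    refine Finset.sum_congr ?_ fun h hh => ?_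
    · ext; simp
    · have : h ∈ nbrs G j := by
        rw [hnbrs]
        exact Finset.mem_of_mem_erase hh
      exact (if_pos this).symm
  · rw [share_eq hq hz hl, hy]
    simp [hmdef, supportedProfile, hl]
  · have hgroup := group_mem_linkGroups hl
    have hw : (m i).w l = w l := if_pos hl
    rw [hw, groupPrice]
    split_ifs with hcl
    · have h1 : proxyPrice G m i l = (m i).p1 l := by
        simp [proxyPrice, hmdef, supportedProfile, mem_clients]
      rw [h1, peers, Finset.add_sum_erase _ (fun j => (m j).p1 l) (mem_groupUsers.2 ⟨hl, rfl⟩),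
        ← h.sum_eq l _ hgroup]
      exact Finset.sum_congr rfl fun j hj => (if_pos (mem_groupUsers.1 hj).1).symm
    · exact (if_pos (center_spec (G := G) hgroup).1).symm
  · rw [zbar1_center hq hl, hy]
    simp [hmdef, supportedProfile, hl]
  · rw [zbar2_center hq hl, hy]
    simp [hmdef, supportedProfile, hl]

/-- Feasibility makes every ratio at least `1`, and a tight link attains `1`. That link has positive
load, so the default `r₀` plays no role. -/
theorem Supports.radial_eq_one (h : Supports net v x p w) (hv : ∀ i, IsValuation (v i)) (i : N) :
    radial G (supportedProfile G x p w) r₀ i = 1 := by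
  have hload : ∀ l, load G (supportedProfile G x p w) i l =
      ∑ k ∈ linkGroups net l, groupMax net x k l :=
    load_eq h.mismatch_eq_zero h.isProfile i
  obtain ⟨l, hl⟩ := h.exists_tight hv i
  have hmem : l ∈ Finset.univ.filter fun l => 0 < load G (supportedProfile G x p w) i l := by
    simp [hload, hl, net.cap_pos l]
  rw [radial, dif_pos ⟨l, by simpa using hmem⟩]
  apply le_antisymm
  · refine (Finset.inf'_le _ (b := l) (by simpa using hmem)).trans ?_
    rw [hload, hl, div_self (net.cap_pos l).ne']
  · refine Finset.le_inf' _ _ fun l' hl' => ?_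
    have hl'' : 0 < load G (supportedProfile G x p w) i l' := by simpa using hl'
    rw [le_div_iff₀ hl'', one_mul, hload]
    exact h.feasible.2 l'

/-- Complementary slackness reduces each `adjustment` to a square, for every deviation, and this
square is zero at the profile itself. What remains is price-taking optimality in `y`. -/
theorem Supports.isNash (h : Supports net v x p w) (hv : ∀ i, IsValuation (v i)) :
    IsNash G (supportedProfile G x p w) v r₀ := by
  have hc := h.mismatch_eq_zero (G := G)
  have hm := h.isProfile (G := G)
  refine isNash_iff.2 ⟨hm, fun i μ hμ => ?_⟩
  have hr := h.radial_eq_one (G := G) (r₀ := r₀) hv i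
  have hload := load_eq hc hm i
  set m := supportedProfile G x p w with hmdef
  have hy : (fun j => (m j).y) = x := rfl
  have hyi : (m i).y = x i := rfl
  have hadj : ∀ l ∈ net.route i, ∀ p' a', adjustment G m r₀ i l p' a' =
      (groupPrice G m i l - proxyPrice G m i l + p' + a' - (m (G.Φ i)).a2 i l -
        wbar G m i l) ^ 2 := by
    intro l hl p' a'
    have hwbar : wbar G m i l = w l := wbar_eq_of_forall hl fun j hj => if_pos hj
    have hp : proxyPrice G m i l = p i l := by
      rw [proxyPrice_eq hc hl]
      exact if_pos hl
    have hz : zbar1 G m i l = groupMax net x (net.group i) l :=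
      zbar1_eq (proxyDemand_eq hc) (z_eq hc) hl
    rw [adjustment, hz, proxyDemand_eq hc, hyi, hr, hload, hwbar, hp, hy]
    linear_combination (groupPrice G m i l - p i l + p' + a' - (m (G.Φ i)).a2 i l - w l) *
      (net.cap l - ∑ k ∈ linkGroups net l, groupMax net x k l) * h.slack l +
      (p' - p i l) * (groupMax net x (net.group i) l - x i) * h.top i l hl
  have hown : ∀ l ∈ net.route i, adjustment G m r₀ i l ((m i).p1 l) ((m i).a1 l) = 0 := by
    intro l hl
    have hwbar : wbar G m i l = w l := wbar_eq_of_forall hl fun j hj => if_pos hj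
    have hw : (m i).w l = w l := if_pos hl
    rw [hadj l hl, groupPrice_eq hc hl, proxyPrice_eq hc hl, proxy_a_eq hc hl, hwbar, hw]
    ring
  have hP : ∀ t, ∑ l ∈ net.route i, proxyPrice G m i l * t = (∑ l ∈ net.route i, p i l) * t := by
    intro t
    rw [Finset.sum_mul]
    refine Finset.sum_congr rfl fun l hl => ?_
    rw [proxyPrice_eq hc hl]
    exact congrArg (· * t) (if_pos hl)
  rw [payoff, payoff, hc i, hr, hyi, Finset.sum_add_distrib, Finset.sum_add_distrib, hP, hP,
    Finset.sum_eq_zero hown]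
  have h1 := h.opt i (1 * μ.y) (by linarith [hμ.1])
  have h2 := mismatch_nonneg (G := G) m i μ
  have h3 : 0 ≤ ∑ l ∈ net.route i, adjustment G m r₀ i l (μ.p1 l) (μ.a1 l) :=
    Finset.sum_nonneg fun l hl => by
      rw [hadj l hl]
      positivity
  simp only [one_mul] at h1 ⊢
  linarith

end Existence

/-! ### From an equilibrium to supporting prices -/

section Necessity

variable {m : N → Message N L} (h : IsNash G m v r₀)
include h

theorem IsNash.isProfile : IsProfile G m := h.1

/-- Deviating to the suggested values while keeping `y`, `¹p` and `¹a` changes nothing but the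
mismatch. -/
theorem IsNash.mismatch_eq_zero (i : N) : mismatch G m i (m i) = 0 := by
  have h1 := (isNash_iff.1 h).2 i _ (h.isProfile.truthful_mem (h.isProfile.y_nonneg i)
    (h.isProfile.p1_spec i) (h.isProfile.a1_spec i))
  rw [payoff, payoff, mismatch_truthful] at h1
  simp only [truthful] at h1
  linarith [mismatch_nonneg (G := G) m i (m i)]

theorem IsNash.payoff_le {i : N} {y : ℝ} (hy : 0 ≤ y) {p a : L → ℝ}
    (hp : NonnegOn (fun l => l ∈ net.route i) p) (ha : PosOn (fun l => l ∈ net.route i) a) :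
    v i (radial G m r₀ i * y) - ∑ l ∈ net.route i, ((m i).p1 l * (radial G m r₀ i * y) +
        adjustment G m r₀ i l (p l) (a l)) ≤
      v i (radial G m r₀ i * (m i).y) - ∑ l ∈ net.route i,
        ((m i).p1 l * (radial G m r₀ i * (m i).y) +
          adjustment G m r₀ i l ((m i).p1 l) ((m i).a1 l)) := by
  have h1 := (isNash_iff.1 h).2 i _ (h.isProfile.truthful_mem hy hp ha)
  have h2 : ∀ t, ∀ f : L → ℝ, ∑ l ∈ net.route i, (proxyPrice G m i l * t + f l) =
      ∑ l ∈ net.route i, ((m i).p1 l * t + f l) := fun t f =>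
    Finset.sum_congr rfl fun l hl => by rw [proxyPrice_eq h.mismatch_eq_zero hl]
  rw [payoff, payoff, mismatch_truthful, h.mismatch_eq_zero] at h1
  simpa only [truthful, zero_add, h2] using h1

/-- The radial factor is positive and independent of the own demand, so the agent can reach any rate
`t` by demanding `t` divided by it. -/
theorem IsNash.opt (hr₀ : ∀ i, 0 < r₀ i) (i : N) {t : ℝ} (ht : 0 ≤ t) :
    v i t - (∑ l ∈ net.route i, (m i).p1 l) * t ≤
      v i (alloc G m r₀ i) - (∑ l ∈ net.route i, (m i).p1 l) * alloc G m r₀ i := by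
  have hr := radial_pos (G := G) hr₀ m i
  have h1 := h.payoff_le (i := i) (y := t / radial G m r₀ i) (by positivity)
    (h.isProfile.p1_spec i) (h.isProfile.a1_spec i)
  rw [mul_div_cancel₀ _ hr.ne', Finset.sum_add_distrib, Finset.sum_add_distrib,
    ← Finset.sum_mul, ← Finset.sum_mul] at h1
  rw [alloc]
  linarith

theorem IsNash.adjustment_le {i : N} {l : L} (hl : l ∈ net.route i) {p a : ℝ} (hp : 0 ≤ p)
    (ha : 0 < a) :
    adjustment G m r₀ i l ((m i).p1 l) ((m i).a1 l) ≤ adjustment G m r₀ i l p a := by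
  classical
  have h1 := h.payoff_le (i := i) (h.isProfile.y_nonneg i)
    (p := Function.update (m i).p1 l p) (a := Function.update (m i).a1 l a)
    (fun l' => by
      by_cases hll : l' = l
      · subst hll; simp [hp, hl]
      · simpa [hll] using h.isProfile.p1_spec i l')
    (fun l' => by
      by_cases hll : l' = l
      · subst hll; simp [ha, hl]
      · simpa [hll] using h.isProfile.a1_spec i l')
  rw [Finset.sum_add_distrib, Finset.sum_add_distrib,
    ← Finset.add_sum_erase _ (fun l' => adjustment G m r₀ i l' (Function.update (m i).p1 l p l')
      (Function.update (m i).a1 l a l')) hl,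
    ← Finset.add_sum_erase _ (fun l' => adjustment G m r₀ i l' ((m i).p1 l') ((m i).a1 l')) hl]
    at h1
  have h2 : ∑ l' ∈ (net.route i).erase l, adjustment G m r₀ i l'
      (Function.update (m i).p1 l p l') (Function.update (m i).a1 l a l') =
      ∑ l' ∈ (net.route i).erase l, adjustment G m r₀ i l' ((m i).p1 l') ((m i).a1 l') :=
    Finset.sum_congr rfl fun l' hl' => by
      rw [Function.update_of_ne (Finset.ne_of_mem_erase hl'),
        Function.update_of_ne (Finset.ne_of_mem_erase hl')]
  simp only [Function.update_self] at h1
  linarith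

/-- The first-order condition with respect to `¹a`. -/
theorem IsNash.first_order {i : N} {l : L} (hl : l ∈ net.route i) :
    wbar G m i l * (net.cap l - radial G m r₀ i * load G m i l) ^ 2 +
      2 * ((m i).w l - wbar G m i l) = 0 := by
  have hc := h.mismatch_eq_zero
  have ha := (h.isProfile.a1_spec i l).1 hl
  set a := (m i).a1 l
  set c := wbar G m i l * (net.cap l - radial G m r₀ i * load G m i l) ^ 2 +
      2 * ((m i).w l - wbar G m i l) with hcdef
  -- Changing `¹a` by `δ` changes the adjustment by exactly `c * δ + δ ^ 2`. As `¹a` is positive,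
  -- small `δ` of either sign are allowed, which forces `c = 0`.
  have key : ∀ δ, -a < δ → 0 ≤ c * δ + δ ^ 2 := by
    intro δ hδ
    have h1 := h.adjustment_le hl (h.isProfile.p1_spec i l).1 (a := a + δ) (by linarith)
    rw [adjustment, adjustment, groupPrice_eq hc hl, proxyPrice_eq hc hl, proxy_a_eq hc hl] at h1
    simp only [hcdef]
    linarith
  rcases lt_trichotomy c 0 with hneg | hzero | hpos
  · nlinarith [key (-c / 2) (by linarith)]
  · exact hzero
  · have hmin : 0 < min (c / 2) (a / 2) := by positivity
    have h1 := key (-min (c / 2) (a / 2)) (by linarith [min_le_right (c / 2) (a / 2)])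
    nlinarith [min_le_left (c / 2) (a / 2)]

theorem IsNash.p1_mul_sq {i : N} {l : L} (hl : l ∈ net.route i) :
    (m i).p1 l * (zbar1 G m i l - (m i).y) = 0 := by
  have hc := h.mismatch_eq_zero
  have ha := (h.isProfile.a1_spec i l).1 hl
  have hp := (h.isProfile.p1_spec i l).1
  -- Lower `¹p` to `0` and raise `¹a` by the same amount: `ŵ` is unchanged, so only the last term of
  -- the adjustment reacts.
  have h1 := h.adjustment_le hl le_rfl (a := (m i).a1 l + (m i).p1 l) (by linarith)
  rw [adjustment, adjustment, groupPrice_eq hc hl, proxyPrice_eq hc hl, proxy_a_eq hc hl,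
    proxyDemand_eq hc] at h1
  have h2 : ((m i).p1 l * (zbar1 G m i l - (m i).y)) ^ 2 ≤ 0 := by nlinarith
  exact pow_eq_zero_iff two_ne_zero |>.1 (le_antisymm h2 (sq_nonneg _))

/-- The slack term in `first_order` is nonnegative, so no quote exceeds the average of the
neighbours' quotes. -/
theorem IsNash.exists_w : ∃ w : L → ℝ, ∀ i l, l ∈ net.route i → (m i).w l = w l := by
  have h1 : ∀ l, ∃ i, l ∈ net.route i := fun l => by
    obtain ⟨i, -, hi, -⟩ := net.two_groups l
    exact ⟨i, hi⟩
  choose i hi using h1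
  refine ⟨fun l => (m (i l)).w l, fun j l hj => w_eq_of_le_wbar (G := G) (fun j hj => ?_) hj (hi l)⟩
  have h2 := h.first_order hj
  have h3 : 0 ≤ wbar G m j l * (net.cap l - radial G m r₀ j * load G m j l) ^ 2 :=
    mul_nonneg (h.isProfile.wbar_nonneg j l) (sq_nonneg _)
  linarith

theorem IsNash.exists_supports (hr₀ : ∀ i, 0 < r₀ i) :
    ∃ w, Supports net v (alloc G m r₀) (fun i l => (m i).p1 l) w := by
  have hm := h.isProfile
  have hc := h.mismatch_eq_zero
  obtain ⟨w, hw⟩ := h.exists_w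
  set f : L → ℝ := fun l => ∑ k ∈ linkGroups net l, groupMax net (fun j => (m j).y) k l
  have hload : ∀ i l, load G m i l = f l := load_eq hc hm
  have hf : ∀ l, 0 ≤ f l := fun l =>
    Finset.sum_nonneg fun k _ => groupMax_nonneg hm.y_nonneg k l
  -- All agents see the same loads. If one is positive, the radial factors coincide. Otherwise all
  -- demands are zero, so the defaults `r₀ i`, which may differ, only multiply zeros and `R = 1`
  -- serves.
  have hR : ∃ R, 0 ≤ R ∧ ∀ i, alloc G m r₀ i = R * (m i).y ∧
      ∀ l, radial G m r₀ i * f l = R * f l := by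
    by_cases hpos : ∃ l, 0 < f l
    · obtain ⟨l, hl⟩ := hpos
      obtain ⟨i₀, -, -, -⟩ := net.two_groups l
      have hrad : ∀ i, radial G m r₀ i = radial G m r₀ i₀ := by
        intro i
        have hne : (Finset.univ.filter fun l => 0 < f l).Nonempty := ⟨l, by simpa using hl⟩
        simp only [radial, hload]
        rw [dif_pos (by convert hne), dif_pos (by convert hne)]
      exact ⟨_, (radial_pos hr₀ m i₀).le, fun i => ⟨by rw [alloc, hrad i], fun l => by rw [hrad i]⟩⟩
    · push Not at hpos
      refine ⟨1, zero_le_one, fun i => ⟨?_, fun l => by rw [le_antisymm (hpos l) (hf l)]; simp⟩⟩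
      obtain ⟨l, hl⟩ := net.route_nonempty i
      have h1 : (m i).y ≤ f l :=
        (le_groupMax (fun j => (m j).y) (mem_groupUsers.2 ⟨hl, rfl⟩)).trans
          (Finset.single_le_sum (f := fun k => groupMax net (fun j => (m j).y) k l)
            (fun k _ => groupMax_nonneg hm.y_nonneg k l) (group_mem_linkGroups hl))
      rw [alloc, le_antisymm (h1.trans (hpos l)) (hm.y_nonneg i), mul_zero, mul_zero]
  obtain ⟨R, hR0, hR⟩ := hR
  have halloc : alloc G m r₀ = fun i => R * (m i).y := funext fun i => (hR i).1
  have hsum : ∀ l, ∑ k ∈ linkGroups net l, groupMax net (alloc G m r₀) k l = R * f l := by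
    intro l
    rw [halloc, Finset.mul_sum]
    exact Finset.sum_congr rfl fun k hk => groupMax_mul hR0 hk
  refine ⟨w, ⟨fun i => ?_, fun l => ?_⟩, fun i l _ => (hm.p1_spec i l).1, fun l k hk => ?_,
    fun l => ?_, fun i l hl => ?_, fun i t ht => h.opt hr₀ i ht⟩
  · rw [halloc]
    exact mul_nonneg hR0 (hm.y_nonneg i)
  · obtain ⟨i, -, -, -⟩ := net.two_groups l
    rw [hsum, ← (hR i).2, ← hload i]
    exact radial_mul_load_le r₀ (by rw [hload]; exact hf l)
  · rw [sum_p1_eq hc hk]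
    exact hw _ l (center_spec (G := G) hk).1
  · obtain ⟨i, -, hi, -⟩ := net.two_groups l
    -- With equal quotes, the first-order condition reduces to `w l` times the squared slack.
    have h1 := h.first_order hi
    rw [wbar_eq_of_forall hi fun j hj => hw j l hj, hw i l hi, hload, (hR i).2, sub_self,
      mul_zero, add_zero] at h1
    rw [hsum]
    rcases mul_eq_zero.1 h1 with h2 | h2
    · rw [h2, zero_mul]
    · rw [pow_eq_zero_iff two_ne_zero |>.1 h2, mul_zero]
  · have h1 := h.p1_mul_sq hl
    rw [zbar1_eq (proxyDemand_eq hc) (z_eq hc) hl] at h1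
    rw [halloc, groupMax_mul hR0 (group_mem_linkGroups hl)]
    linear_combination R * h1

/-- At an equilibrium every agent just pays its prices for its allocation. -/
theorem IsNash.tax_eq (i : N) :
    tax G m r₀ i = (∑ l ∈ net.route i, (m i).p1 l) * alloc G m r₀ i := by
  have hc := h.mismatch_eq_zero
  obtain ⟨w, hw⟩ := h.exists_w
  rw [Multicast.tax_eq, hc, zero_add, Finset.sum_mul]
  refine Finset.sum_congr rfl fun l hl => ?_
  rw [adjustment, groupPrice_eq hc hl, proxyPrice_eq hc hl, proxy_a_eq hc hl,
    wbar_eq_of_forall hl fun j hj => hw j l hj, hw i l hl]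
  ring

end Necessity

end Equilibrium

end Multicast

theorem theorem1 {N L K : Type*} [Fintype N] [Fintype L] [Fintype K]
    (net : Multicast.Network N L K) (G : Multicast.MessageGraph net)
    (v : N → ℝ → ℝ) (hv : ∀ i, Multicast.IsValuation (v i))
    (r₀ : N → ℝ) (hr₀ : ∀ i, 0 < r₀ i) :
    -- the mechanism is distributed
    (∀ (i : N) (m m' : N → Multicast.Message N L),
      (∀ j, j = i ∨ G.graph.Adj i j → m j = m' j) →
        Multicast.alloc G m r₀ i = Multicast.alloc G m' r₀ i ∧
          Multicast.tax G m r₀ i = Multicast.tax G m' r₀ i) ∧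
    -- a Nash equilibrium exists
    (∃ m, Multicast.IsNash G m v r₀) ∧
    -- the welfare problem has a unique solution, which every equilibrium implements
    ∃ xs : N → ℝ, Multicast.IsSolution net v xs ∧
      (∀ x, Multicast.IsSolution net v x → x = xs) ∧
      ∀ m, Multicast.IsNash G m v r₀ →
        (∀ i, Multicast.alloc G m r₀ i = xs i) ∧
        (∀ i, v i 0 ≤ v i (Multicast.alloc G m r₀ i) - Multicast.tax G m r₀ i) ∧
        0 ≤ ∑ i, Multicast.tax G m r₀ i := by
  obtain ⟨xs, hxs⟩ := Multicast.exists_isSolution net hv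
  obtain ⟨p, w, hsupp⟩ := hxs.exists_supports hv
  refine ⟨fun i m m' h => ?_, ⟨_, hsupp.isNash hv⟩, xs, hxs,
    fun x hx => hsupp.eq_of_isSolution hv hx, fun m hm => ⟨?_, fun i => ?_, ?_⟩⟩
  · have hadj : ∀ j, G.graph.Adj i j → m j = m' j := fun j hj => h j (Or.inr hj)
    exact ⟨Multicast.alloc_congr hadj r₀ (h i (Or.inl rfl)),
      Multicast.tax_congr hadj r₀ (h i (Or.inl rfl))⟩
  · obtain ⟨w', hsupp'⟩ := hm.exists_supports hr₀
    exact congrFun (hsupp.eq_of_isSolution hv hsupp'.isSolution)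
  · rw [hm.tax_eq]
    -- Individual rationality is price-taking optimality compared with the rate `0`, which costs
    -- nothing.
    simpa using hm.opt hr₀ i le_rfl
  · refine Finset.sum_nonneg fun i _ => ?_
    rw [hm.tax_eq]
    exact mul_nonneg (Finset.sum_nonneg fun l _ => (hm.isProfile.p1_spec i l).1)
      (mul_nonneg (Multicast.radial_pos hr₀ m i).le (hm.isProfile.y_nonneg i))
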